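/- Let $E$ be a finite-dimensional real inner product space with norm $\|\cdot\|$ and Lebesgue measure (for instance $\mathbb{R}^d$ with $\|z\|^2=d^{-1}\sum_{j}z_j^2$), and let $k\ge 1$. Let $Z$ be a random vector in $E$ and $Z_1,Z_2,\dots$ independent copies of $Z$. For $x=(x^1,\dots,x^k)\in E^k$ and $z\in E$ let $I_r(z;x)=\prod_{j=1}^k \mathbf 1\{\|z-x^r\|\le\|z-x^j\|\}$, and put $$g(x)=\mathbb{E}\Big[\min_{1\le r\le k}\|Z-x^r\|\Big],\qquad \nabla_r g(x)=\mathbb{E}\Big[I_r(Z;x)\frac{x^r-Z}{\|x^r-Z\|}\Big],\qquad \nabla g=(\nabla_1 g,\dots,\nabla_k g).$$ The stationary points of $g$ are the zeros of $\nabla g$. Let $X_1=(X_1^1,\dots,X_1^k)$ be a random vector in $E^k$, independent of $(Z_n)_{n\ge1}$, and define, for $n\ge 1$ and $1\le r\le k$, $$X_{n+1}^r=X_n^r-a_n^r\,I_r(Z_n;X_n)\frac{X_n^r-Z_n}{\|X_n^r-Z_n\|},$$ where the real random steps $a_n^r$ are measurable with respect to $\sigma(X_1,Z_1,\dots,Z_{n-1})$.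 Let $K>0$ and $C$ be constants. Assume that $X_1$ is absolutely continuous with respect to Lebesgue measure on $E^k$, that $\|X_1^r\|\le K$ a.s. for every $r$, and that the following hold. (H1a) $Z$ is absolutely continuous with respect to Lebesgue measure. (H1c) $\mathbb{E}\big[1/\|Z-x\|\big]<C$ for all $x\in E$ with $\|x\|\le K+1$. (H2a) Almost surely, $\min_r a_n^r>0$ for all $n\ge1$. (H2b) $\max_r\sup_n a_n^r<\min\big(\tfrac12,\tfrac1{8C}\big)$ a.s. (H3) or (H3'): either $\sum_{r}\sum_{n}(a_n^r)^2<\infty$ a.s., or $\sum_{r}\sum_n\mathbb{E}\big[(a_n^r)^2I_r(Z_n;X_n)\big]<\infty$. 1. Suppose that either (H1b) $\|Z\|\le K$ a.s., or $\mathbb{E}\|Z\|<\infty$ and the bound in (H1c) holds for every $x\in E$. Then $g(X_n)$ and $\sum_{r=1}^k\sum_{n=1}^\infty a_n^r\|\nabla_r g(X_n)\|^2$ converge almost surely (to finite limits). 2. Suppose that (H1b) holds, that (H2c) $\sum_{n}\max_r a_n^r=\infty$ a.s., and that (H2d) $\sup_n \max_r a_n^r/\min_r a_n^r<\infty$ a.s.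 Then, almost surely, $\nabla g(X_n)\to0$ and the distance from $X_n$ to the set of stationary points of $g$ tends to $0$. -/

import Mathlib

open MeasureTheory ProbabilityTheory Filter Topology
open scoped ENNReal

noncomputable section

namespace KMedians

/-- A system `x = (x¹, …, xᵏ)` of `k` centres in `E`, with the Euclidean product norm
`‖x‖² = ∑ᵣ ‖xʳ‖²`; the `r`-th centre is `x r`. -/
abbrev Centers (E : Type*) (k : ℕ) : Type _ := PiLp 2 (fun _ : Fin k => E)

variable {E : Type*} [NormedAddCommGroup E] [InnerProductSpace ℝ E]

/-- `I_r(z; x) = ∏ⱼ 1{‖z - xʳ‖ ≤ ‖z - xʲ‖}`: equal to one when `xʳ` is a nearest centre to `z`,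
and to zero otherwise. -/
def nearest {k : ℕ} (r : Fin k) (z : E) (x : Centers E k) : ℝ :=
  ∏ j : Fin k, if ‖z - x r‖ ≤ ‖z - x j‖ then 1 else 0

/-- The stochastic direction `I_r(z; x) (xʳ - z) / ‖xʳ - z‖` (with value `0` at `z = xʳ`). -/
def direction {k : ℕ} (r : Fin k) (z : E) (x : Centers E k) : E :=
  (nearest r z x / ‖x r - z‖) • (x r - z)

variable [MeasurableSpace E]

/-- The `k`-medians objective `g(x) = 𝔼[min_r ‖Z - xʳ‖]`, where `ν` is the law of `Z`. -/
def objective {k : ℕ} (ν : Measure E) (x : Centers E k) : ℝ :=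
  ∫ z, ⨅ r : Fin k, ‖z - x r‖ ∂ν

/-- `∇g(x) = (∇₁g(x), …, ∇ₖg(x))` with `∇ᵣg(x) = 𝔼[I_r(Z; x) (xʳ - Z) / ‖xʳ - Z‖]`, where `ν` is
the law of `Z`. -/
def grad {k : ℕ} (ν : Measure E) (x : Centers E k) : Centers E k :=
  WithLp.toLp 2 fun r => ∫ z, direction r z x ∂ν

/-- The stationary points of the objective: the zeros of `∇g`. -/
def stationaryPoints (k : ℕ) (ν : Measure E) : Set (Centers E k) :=
  {x | grad ν x = 0}

/-- The `σ`-field generated by the initial centres and the first `n` observations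
`Z 0, …, Z (n - 1)`. -/
abbrev history {Ω : Type*} {k : ℕ} (X₀ : Ω → Centers E k) (Z : ℕ → Ω → E) (n : ℕ) :
    MeasurableSpace Ω :=
  MeasurableSpace.comap X₀ inferInstance ⊔
    ⨆ i : Fin n, MeasurableSpace.comap (Z i) inferInstance

end KMedians

end

/-! The first part is a descent argument. At distinct centres almost every `z` has a unique nearest
centre, so the second-order upper expansion of the norm can be integrated over `z`; the bound on the
mean inverse distance turns this into a quadratic upper bound for the objective with constant `C /
2` (`objective_le`). Applied to one step and averaged over the fresh observation, it says that the
objective decreases in conditional mean by `∑ a ‖∇ᵣg‖²`, up to an error `(C / 2) ∑ a² P(cell r)`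
(`setIntegral_objective_succ_le`). The errors are summable by either form of (H3), and the
Robbins–Siegmund theorem concludes.

The centres stay distinct because the dimension is at least two: on a line `1 / |z - x|` is not
locally integrable, which contradicts (H1c) (`two_le_finrank`). For almost every observation at
least one of two given centres stays put, and the other can land on it only if the observation lies
on the line joining them, a null set (`ae_sub_smul_direction_ne`).

In the second part the difficulty is that the gradient may be discontinuous where centres coincide.
If two centres merge while their gradients vanish, however, each of their cells loses all its mass:
on its cell the unit direction has an almost nonpositive component along the merging axis, the mean
of that component tends to zero, hence so does its `L¹` norm, and the limiting component is nonzero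
almost everywhere (`tendsto_nearestProb_of_merge`). So every limit of distinct centres along which
the gradient vanishes is a stationary point where the gradient is continuous
(`continuousAt_grad_of_tendsto`). If the gradient did not tend to zero, the summability of `∑ α
‖∇g‖²` would give arbitrarily short excursions from almost zero gradient to gradient at least `ε`
(`exists_short_excursion`), contradicting continuity at a limit of their starting points. -/

noncomputable section

namespace KMedians

/-! ### Almost supermartingale convergence -/

/-- A truncated Robbins–Siegmund process: the drift-corrected increments of `V` are only added as
long as the accumulated noise `B` stays below `m`. -/
def truncatedProcess {Ω : Type*} (V A B : ℕ → Ω → ℝ) (m : ℝ) (n : ℕ) (ω : Ω) : ℝ :=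
  V 0 ω + ∑ i ∈ Finset.range n,
    {ω | ∑ j ∈ Finset.range (i + 1), B j ω ≤ m}.indicator
      (fun ω => V (i + 1) ω - V i ω + A i ω - B i ω) ω

lemma truncatedProcess_succ {Ω : Type*} (V A B : ℕ → Ω → ℝ) (m : ℝ) (n : ℕ) (ω : Ω) :
    truncatedProcess V A B m (n + 1) ω = truncatedProcess V A B m n ω +
      {ω | ∑ j ∈ Finset.range (n + 1), B j ω ≤ m}.indicator
        (fun ω => V (n + 1) ω - V n ω + A n ω - B n ω) ω := by
  simp only [truncatedProcess, Finset.sum_range_succ _ n, add_assoc]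

lemma truncatedProcess_eq {Ω : Type*} {V A B : ℕ → Ω → ℝ} {m : ℝ} {n : ℕ} {ω : Ω}
    (hB : ∀ n, 0 ≤ B n ω) (h : ∑ j ∈ Finset.range n, B j ω ≤ m) :
    truncatedProcess V A B m n ω =
      V n ω + ∑ j ∈ Finset.range n, A j ω - ∑ j ∈ Finset.range n, B j ω := by
  induction n with
  | zero => simp [truncatedProcess]
  | succ n ih =>
    rw [truncatedProcess_succ, Set.indicator_of_mem (by exact h), ih]
    · simp only [Finset.sum_range_succ]; ring
    · rw [Finset.sum_range_succ] at h
      linarith [hB n]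

/-- While the gate is open the process is `V + ∑ A - ∑ B` with `∑ B ≤ m`; once it closes, the
process is frozen. -/
lemma neg_le_truncatedProcess {Ω : Type*} {V A B : ℕ → Ω → ℝ} {m : ℝ} (hm : 0 ≤ m) {ω : Ω}
    (hV : ∀ n, 0 ≤ V n ω) (hA : ∀ n, 0 ≤ A n ω) (hB : ∀ n, 0 ≤ B n ω) (n : ℕ) :
    -m ≤ truncatedProcess V A B m n ω := by
  induction n with
  | zero => simp only [truncatedProcess, Finset.range_zero, Finset.sum_empty]; linarith [hV 0]
  | succ n ih =>
    by_cases h : ∑ j ∈ Finset.range (n + 1), B j ω ≤ m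
    · rw [truncatedProcess_eq hB h]
      have := Finset.sum_nonneg (s := Finset.range (n + 1)) fun j _ => hA j
      linarith [hV (n + 1)]
    · rw [truncatedProcess_succ, Set.indicator_of_notMem (by exact h)]
      linarith

section Probability

variable {Ω : Type*} [mΩ : MeasurableSpace Ω] {P : Measure Ω}

lemma integrable_truncatedProcess {V A B : ℕ → Ω → ℝ} {m : ℝ}
    (hB : ∀ n, Measurable (B n))
    (hVi : ∀ n, Integrable (V n) P) (hAi : ∀ n, Integrable (A n) P)
    (hBi : ∀ n, Integrable (B n) P) (n : ℕ) :
    Integrable (truncatedProcess V A B m n) P := by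
  refine (hVi 0).add (integrable_finsetSum _ fun i _ => Integrable.indicator ?_ ?_)
  · exact (((hVi _).sub (hVi _)).add (hAi _)).sub (hBi _)
  · exact measurableSet_le (Finset.measurable_sum _ fun j _ => hB j) measurable_const

lemma supermartingale_truncatedProcess [IsFiniteMeasure P] {ℱ : Filtration ℕ mΩ}
    {V A B : ℕ → Ω → ℝ} {m : ℝ}
    (hV : ∀ n, Measurable[ℱ n] (V n)) (hA : ∀ n, Measurable[ℱ n] (A n))
    (hB : ∀ n, Measurable[ℱ n] (B n))
    (hVi : ∀ n, Integrable (V n) P) (hAi : ∀ n, Integrable (A n) P)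
    (hBi : ∀ n, Integrable (B n) P)
    (hstep : ∀ n (s : Set Ω), MeasurableSet[ℱ n] s →
      ∫ ω in s, V (n + 1) ω ∂P ≤ ∫ ω in s, (V n ω - A n ω + B n ω) ∂P) :
    Supermartingale (truncatedProcess V A B m) ℱ P := by
  -- The gate for the increment from `n` to `n + 1` involves `B 0, …, B n` only, so it is known at
  -- time `n`.
  have hSm : ∀ n, MeasurableSet[ℱ n] {ω | ∑ j ∈ Finset.range (n + 1), B j ω ≤ m} := fun n =>
    measurableSet_le (Finset.measurable_sum _ fun j hj =>
      (hB j).mono (ℱ.mono (by simp at hj; omega)) le_rfl) measurable_const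
  have hB' : ∀ n, Measurable (B n) := fun n => (hB n).mono (ℱ.le n) le_rfl
  have hint := integrable_truncatedProcess (m := m) hB' hVi hAi hBi
  refine supermartingale_of_setIntegral_succ_le (fun n => ?_) hint fun n s hs => ?_
  · refine Measurable.stronglyMeasurable ?_
    refine Measurable.add ((hV 0).mono (ℱ.mono (Nat.zero_le n)) le_rfl)
      (Finset.measurable_sum _ fun i hi => ?_)
    have hi' : i + 1 ≤ n := by simpa using hi
    have hle : ℱ i ≤ ℱ n := ℱ.mono (by omega)
    refine Measurable.indicator (m := ℱ n) ?_ (hle _ (hSm i))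
    exact ((((hV (i + 1)).mono (ℱ.mono hi') le_rfl).sub ((hV i).mono hle le_rfl)).add
      ((hA i).mono hle le_rfl)).sub ((hB i).mono hle le_rfl)
  · have hD : Integrable (fun ω => V (n + 1) ω - V n ω + A n ω - B n ω) P :=
      (((hVi _).sub (hVi _)).add (hAi _)).sub (hBi _)
    have hS := ℱ.le n _ (hSm n)
    simp only [truncatedProcess_succ]
    rw [integral_add (hint n).integrableOn (hD.indicator hS).integrableOn,
      setIntegral_indicator hS]
    have h1 := hstep n _ (MeasurableSet.inter (m := ℱ n) hs (hSm n))
    have h2 : ∫ ω in s ∩ {ω | ∑ j ∈ Finset.range (n + 1), B j ω ≤ m},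
        (V (n + 1) ω - V n ω + A n ω - B n ω) ∂P =
        ∫ ω in s ∩ {ω | ∑ j ∈ Finset.range (n + 1), B j ω ≤ m}, V (n + 1) ω ∂P -
        ∫ ω in s ∩ {ω | ∑ j ∈ Finset.range (n + 1), B j ω ≤ m}, (V n ω - A n ω + B n ω) ∂P := by
      have hE : Integrable (fun ω => V n ω - A n ω + B n ω) P :=
        ((hVi _).sub (hAi _)).add (hBi _)
      rw [← integral_sub (hVi _).integrableOn hE.integrableOn]
      congr 1
      ext ω
      ring
    rw [h2]
    linarith

/-- A supermartingale bounded below by `-m` is bounded in `L¹`, since `|W| ≤ W + 2m` and its mean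
does not increase; Doob's theorem applies to `-W`. -/
lemma ae_exists_tendsto_truncatedProcess [IsFiniteMeasure P] {ℱ : Filtration ℕ mΩ}
    {V A B : ℕ → Ω → ℝ} {m : ℝ} (hm : 0 ≤ m)
    (hV : ∀ n, Measurable[ℱ n] (V n)) (hA : ∀ n, Measurable[ℱ n] (A n))
    (hB : ∀ n, Measurable[ℱ n] (B n))
    (hVi : ∀ n, Integrable (V n) P) (hAi : ∀ n, Integrable (A n) P)
    (hBi : ∀ n, Integrable (B n) P)
    (hV0 : ∀ᵐ ω ∂P, ∀ n, 0 ≤ V n ω) (hA0 : ∀ᵐ ω ∂P, ∀ n, 0 ≤ A n ω)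
    (hB0 : ∀ᵐ ω ∂P, ∀ n, 0 ≤ B n ω)
    (hstep : ∀ n (s : Set Ω), MeasurableSet[ℱ n] s →
      ∫ ω in s, V (n + 1) ω ∂P ≤ ∫ ω in s, (V n ω - A n ω + B n ω) ∂P) :
    ∀ᵐ ω ∂P, ∃ l, Tendsto (fun n => truncatedProcess V A B m n ω) atTop (𝓝 l) := by
  have hsuper := supermartingale_truncatedProcess (m := m) hV hA hB hVi hAi hBi hstep
  have hB' : ∀ n, Measurable (B n) := fun n => (hB n).mono (ℱ.le n) le_rfl
  have hint := integrable_truncatedProcess (m := m) hB' hVi hAi hBi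
  set W := truncatedProcess V A B m
  have hlow : ∀ n, ∀ᵐ ω ∂P, -m ≤ W n ω := fun n => by
    filter_upwards [hV0, hA0, hB0] with ω h1 h2 h3 using neg_le_truncatedProcess hm h1 h2 h3 n
  have hmean : ∀ n, ∫ ω, W n ω ∂P ≤ ∫ ω, W 0 ω ∂P := fun n => by
    simpa using hsuper.setIntegral_le (Nat.zero_le n) MeasurableSet.univ
  set R : ℝ := ∫ ω, W 0 ω ∂P + 2 * (P.real Set.univ * m)
  have hbound : ∀ n, eLpNorm ((-W) n) 1 P ≤ (R.toNNReal : ℝ≥0∞) := fun n => by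
    rw [Pi.neg_apply, eLpNorm_neg, eLpNorm_one_eq_lintegral_enorm,
      ← ofReal_integral_norm_eq_lintegral_enorm (hint n)]
    refine ENNReal.ofReal_le_ofReal ?_
    have h1 : ∫ ω, ‖W n ω‖ ∂P ≤ ∫ ω, (W n ω + 2 * m) ∂P := by
      refine integral_mono_ae (hint n).norm ((hint n).add (integrable_const _)) ?_
      filter_upwards [hlow n] with ω h
      rw [Real.norm_eq_abs, abs_le]
      constructor <;> linarith
    rw [integral_add (hint n) (integrable_const _), integral_const, smul_eq_mul] at h1
    simp only [R]
    linarith [hmean n]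
  filter_upwards [hsuper.neg.ae_tendsto_limitProcess hbound] with ω hω
  exact ⟨_, by simpa using hω.neg⟩

/-- The Robbins–Siegmund almost supermartingale convergence theorem, with the conditional
inequality in integrated form. -/
theorem ae_tendsto_and_summable_of_almost_supermartingale [IsFiniteMeasure P]
    {ℱ : Filtration ℕ mΩ} {V A B : ℕ → Ω → ℝ}
    (hV : ∀ n, Measurable[ℱ n] (V n)) (hA : ∀ n, Measurable[ℱ n] (A n))
    (hB : ∀ n, Measurable[ℱ n] (B n))
    (hVi : ∀ n, Integrable (V n) P) (hAi : ∀ n, Integrable (A n) P)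
    (hBi : ∀ n, Integrable (B n) P)
    (hV0 : ∀ᵐ ω ∂P, ∀ n, 0 ≤ V n ω) (hA0 : ∀ᵐ ω ∂P, ∀ n, 0 ≤ A n ω)
    (hB0 : ∀ᵐ ω ∂P, ∀ n, 0 ≤ B n ω)
    (hstep : ∀ n (s : Set Ω), MeasurableSet[ℱ n] s →
      ∫ ω in s, V (n + 1) ω ∂P ≤ ∫ ω in s, (V n ω - A n ω + B n ω) ∂P)
    (hBs : ∀ᵐ ω ∂P, Summable fun n => B n ω) :
    ∀ᵐ ω ∂P, (∃ l, Tendsto (fun n => V n ω) atTop (𝓝 l)) ∧ Summable fun n => A n ω := by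
  have hconv : ∀ᵐ ω ∂P, ∀ m : ℕ, ∃ l,
      Tendsto (fun n => truncatedProcess V A B m n ω) atTop (𝓝 l) :=
    ae_all_iff.2 fun m => ae_exists_tendsto_truncatedProcess m.cast_nonneg hV hA hB hVi hAi hBi
      hV0 hA0 hB0 hstep
  filter_upwards [hconv, hV0, hA0, hB0, hBs] with ω hω hV0 hA0 hB0 hBs
  -- On this path the gate of level `m` never closes, so the convergent truncated process is `V + ∑
  -- A - ∑ B` itself.
  obtain ⟨m, hm⟩ := exists_nat_ge (∑' n, B n ω)
  obtain ⟨l, hl⟩ := hω m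
  have hle : ∀ n, ∑ j ∈ Finset.range n, B j ω ≤ m := fun n =>
    (hBs.sum_le_tsum _ fun i _ => hB0 i).trans hm
  have hVA : Tendsto (fun n => V n ω + ∑ j ∈ Finset.range n, A j ω) atTop
      (𝓝 (l + ∑' n, B n ω)) := by
    refine (hl.add hBs.hasSum.tendsto_sum_nat).congr fun n => ?_
    rw [truncatedProcess_eq hB0 (hle n)]
    ring
  obtain ⟨c, hc⟩ := hVA.bddAbove_range
  have hAs : Summable fun n => A n ω := by
    refine summable_of_sum_range_le (c := c) hA0 fun n => ?_
    have := hc ⟨n, rfl⟩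
    simp only at this
    linarith [hV0 n]
  refine ⟨⟨_, (hVA.sub hAs.hasSum.tendsto_sum_nat).congr fun n => by ring⟩, hAs⟩

/-! ### Independence -/

/-- If `m₁` is independent of `m₂ ⊔ m₃`, and `m₂` of `m₃`, then `m₁ ⊔ m₂` is independent of
`m₃`. -/
lemma indep_sup_of_indep_sup [IsProbabilityMeasure P] {m₁ m₂ m₃ : MeasurableSpace Ω}
    (h₁ : m₁ ≤ mΩ) (h₂ : m₂ ≤ mΩ) (h₃ : m₃ ≤ mΩ)
    (h : Indep m₁ (m₂ ⊔ m₃) P) (h' : Indep m₂ m₃ P) : Indep (m₁ ⊔ m₂) m₃ P := by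
  rw [Indep_iff] at h h'
  refine IndepSets.indep (p1 := {s | ∃ A B, MeasurableSet[m₁] A ∧ MeasurableSet[m₂] B ∧ s = A ∩ B})
    (p2 := {s | MeasurableSet[m₃] s}) (sup_le h₁ h₂) h₃ ?_ ?_ ?_ ?_ ?_
  · rintro _ ⟨A, B, hA, hB, rfl⟩ _ ⟨A', B', hA', hB', rfl⟩ -
    exact ⟨A ∩ A', B ∩ B', MeasurableSet.inter (m := m₁) hA hA', MeasurableSet.inter (m := m₂) hB hB',
      Set.inter_inter_inter_comm A B A' B'⟩
  · exact @MeasurableSpace.isPiSystem_measurableSet Ω m₃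
  · refine le_antisymm (sup_le ?_ ?_) (MeasurableSpace.generateFrom_le ?_)
    · exact fun A hA => MeasurableSpace.measurableSet_generateFrom
        ⟨A, Set.univ, hA, MeasurableSet.univ (m := m₂), by simp⟩
    · exact fun B hB => MeasurableSpace.measurableSet_generateFrom
        ⟨Set.univ, B, MeasurableSet.univ (m := m₁), hB, by simp⟩
    · rintro _ ⟨A, B, hA, hB, rfl⟩
      exact MeasurableSet.inter (m := m₁ ⊔ m₂)
        ((le_sup_left : m₁ ≤ m₁ ⊔ m₂) _ hA) ((le_sup_right : m₂ ≤ m₁ ⊔ m₂) _ hB)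
  · exact (@MeasurableSpace.generateFrom_measurableSet Ω m₃).symm
  · rw [IndepSets_iff]
    rintro _ D ⟨A, B, hA, hB, rfl⟩ hD
    have hB' : MeasurableSet[m₂ ⊔ m₃] B := (le_sup_left : m₂ ≤ m₂ ⊔ m₃) _ hB
    have hD' : MeasurableSet[m₂ ⊔ m₃] D := (le_sup_right : m₃ ≤ m₂ ⊔ m₃) _ hD
    rw [Set.inter_assoc, h A _ hA (MeasurableSet.inter (m := m₂ ⊔ m₃) hB' hD'), h' B D hB hD,
      h A B hA hB', mul_assoc]

/-- Fubini on the product law: given `Y`, the independent `Z` may be averaged out with `Y` frozen.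
The weight `b` need only be integrable. -/
lemma integral_comp_eq_of_indepFun [IsProbabilityMeasure P] {α β : Type*} [MeasurableSpace α]
    [MeasurableSpace β] {Y : Ω → α} {Z : Ω → β} (hY : Measurable Y) (hZ : Measurable Z)
    (hYZ : IndepFun Y Z P) {φ : β → α → ℝ} (hφ : Measurable (Function.uncurry φ)) {c : ℝ}
    (hc : ∀ z y, |φ z y| ≤ c) {b : α → ℝ} (hb : Measurable b)
    (hbi : Integrable (fun ω => b (Y ω)) P) :
    ∫ ω, b (Y ω) * φ (Z ω) (Y ω) ∂P = ∫ ω, b (Y ω) * ∫ z, φ z (Y ω) ∂(P.map Z) ∂P := by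
  have := Measure.isProbabilityMeasure_map (μ := P) hZ.aemeasurable
  have := Measure.isProbabilityMeasure_map (μ := P) hY.aemeasurable
  have hmap := (indepFun_iff_map_prod_eq_prod_map_map hY.aemeasurable hZ.aemeasurable).1 hYZ
  have hφ' : Measurable fun p : α × β => φ p.2 p.1 := hφ.comp measurable_swap
  have hm : Measurable fun p : α × β => b p.1 * φ p.2 p.1 := (hb.comp measurable_fst).mul hφ'
  have hbi' : Integrable b (P.map Y) := (integrable_map_measure hb.aestronglyMeasurable
    hY.aemeasurable).2 hbi
  have hint : Integrable (fun p : α × β => b p.1 * φ p.2 p.1) ((P.map Y).prod (P.map Z)) :=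
    (hbi'.comp_fst (P.map Z)).mul_bdd (c := c) hφ'.aestronglyMeasurable
      (Eventually.of_forall fun p => hc _ _)
  calc ∫ ω, b (Y ω) * φ (Z ω) (Y ω) ∂P
      = ∫ p, b p.1 * φ p.2 p.1 ∂(P.map fun ω => (Y ω, Z ω)) :=
        (integral_map (hY.prodMk hZ).aemeasurable hm.aestronglyMeasurable).symm
    _ = ∫ y, ∫ z, b y * φ z y ∂(P.map Z) ∂(P.map Y) := by rw [hmap, integral_prod _ hint]
    _ = ∫ ω, ∫ z, b (Y ω) * φ z (Y ω) ∂(P.map Z) ∂P :=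
        integral_map hY.aemeasurable
          (hm.stronglyMeasurable.integral_prod_right).aestronglyMeasurable
    _ = _ := by simp only [integral_const_mul]

lemma ae_of_indepFun [IsProbabilityMeasure P] {α β : Type*} [MeasurableSpace α]
    [MeasurableSpace β] {Y : Ω → α} {Z : Ω → β} (hY : Measurable Y) (hZ : Measurable Z)
    (hYZ : IndepFun Y Z P) {p : α × β → Prop} (hp : MeasurableSet {q | p q})
    (h : ∀ᵐ ω ∂P, ∀ᵐ z ∂(P.map Z), p (Y ω, z)) : ∀ᵐ ω ∂P, p (Y ω, Z ω) := by
  have := Measure.isProbabilityMeasure_map (μ := P) hZ.aemeasurable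
  have := Measure.isProbabilityMeasure_map (μ := P) hY.aemeasurable
  have hmap := (indepFun_iff_map_prod_eq_prod_map_map hY.aemeasurable hZ.aemeasurable).1 hYZ
  have h1 : ∀ᵐ q ∂(P.map fun ω => (Y ω, Z ω)), p q := by
    rw [hmap, ae_iff]
    refine (Measure.measure_prod_null hp.compl).2 ?_
    exact (ae_map_iff hY.aemeasurable
      (measurable_measure_prodMk_left hp.compl (measurableSet_singleton 0))).2 h
  exact ae_of_ae_map (hY.prodMk hZ).aemeasurable h1

end Probability

/-! ### Geometry of the cells and of the stochastic direction -/

section Nearest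

variable {E : Type*} [NormedAddCommGroup E] {k : ℕ}

lemma nearest_eq_ite (r : Fin k) (z : E) (x : Centers E k) :
    nearest r z x = if ∀ j, ‖z - x r‖ ≤ ‖z - x j‖ then 1 else 0 := by
  simp [nearest, Finset.prod_boole]

lemma nearest_eq_one {r : Fin k} {z : E} {x : Centers E k} (h : ∀ j, ‖z - x r‖ ≤ ‖z - x j‖) :
    nearest r z x = 1 := by
  rw [nearest_eq_ite, if_pos h]

lemma nearest_eq_zero {r j : Fin k} {z : E} {x : Centers E k} (h : ‖z - x j‖ < ‖z - x r‖) :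
    nearest r z x = 0 := by
  rw [nearest_eq_ite, if_neg]
  push Not
  exact ⟨j, h⟩

lemma nearest_eq_zero_or (r : Fin k) (z : E) (x : Centers E k) :
    nearest r z x = 0 ∨ (nearest r z x = 1 ∧ ∀ j, ‖z - x r‖ ≤ ‖z - x j‖) := by
  rw [nearest_eq_ite]
  split_ifs with h
  · exact Or.inr ⟨rfl, h⟩
  · exact Or.inl rfl

lemma nearest_nonneg (r : Fin k) (z : E) (x : Centers E k) : 0 ≤ nearest r z x := by
  rcases nearest_eq_zero_or r z x with h | ⟨h, -⟩ <;> simp [h]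

lemma nearest_le_one (r : Fin k) (z : E) (x : Centers E k) : nearest r z x ≤ 1 := by
  rcases nearest_eq_zero_or r z x with h | ⟨h, -⟩ <;> simp [h]

lemma abs_nearest_le_one (r : Fin k) (z : E) (x : Centers E k) : |nearest r z x| ≤ 1 := by
  rw [abs_of_nonneg (nearest_nonneg r z x)]
  exact nearest_le_one r z x

lemma exists_nearest_eq_one (hk : 1 ≤ k) (z : E) (x : Centers E k) : ∃ r, nearest r z x = 1 := by
  have : Nonempty (Fin k) := ⟨⟨0, hk⟩⟩
  obtain ⟨r, hr⟩ := Finite.exists_min fun r => ‖z - x r‖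
  exact ⟨r, nearest_eq_one hr⟩

lemma one_le_sum_nearest (hk : 1 ≤ k) (z : E) (x : Centers E k) : 1 ≤ ∑ r, nearest r z x := by
  obtain ⟨r, hr⟩ := exists_nearest_eq_one hk z x
  rw [← hr]
  exact Finset.single_le_sum (f := fun r => nearest r z x) (fun s _ => nearest_nonneg s z x)
    (Finset.mem_univ r)

lemma iInf_norm_sub_eq {r : Fin k} {z : E} {x : Centers E k} (h : nearest r z x = 1) :
    ⨅ j, ‖z - x j‖ = ‖z - x r‖ := by
  have : Nonempty (Fin k) := ⟨r⟩
  rcases nearest_eq_zero_or r z x with h' | ⟨-, h'⟩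
  · rw [h'] at h; norm_num at h
  · exact le_antisymm (ciInf_le (Set.finite_range _).bddBelow r) (le_ciInf h')

lemma iInf_norm_sub_nonneg (z : E) (x : Centers E k) : 0 ≤ ⨅ r, ‖z - x r‖ :=
  Real.iInf_nonneg fun _ => norm_nonneg _

lemma iInf_norm_sub_le (r : Fin k) (z : E) (x : Centers E k) : ⨅ j, ‖z - x j‖ ≤ ‖z - x r‖ :=
  ciInf_le (Set.finite_range fun j => ‖z - x j‖).bddBelow r

lemma eventually_apply_lt {r s : Fin k} {z : E} {y : Centers E k} (h : ‖z - y r‖ < ‖z - y s‖) :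
    ∀ᶠ x : Centers E k in 𝓝 y, ‖z - x r‖ < ‖z - x s‖ := by
  have hc : ∀ j, Continuous fun x : Centers E k => ‖z - x j‖ := fun j => by fun_prop
  exact (hc r).continuousAt.eventually_lt (hc s).continuousAt h

lemma measurable_nearest [MeasurableSpace E] [BorelSpace E] [SecondCountableTopology E]
    (r : Fin k) : Measurable fun p : E × Centers E k => nearest r p.1 p.2 := by
  unfold nearest
  refine Finset.measurable_prod _ fun j _ => Measurable.ite ?_ measurable_const measurable_const
  refine measurableSet_le ?_ ?_ <;>
  · refine (measurable_fst.sub ?_).norm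
    fun_prop

variable [InnerProductSpace ℝ E]

lemma norm_direction_le (r : Fin k) (z : E) (x : Centers E k) :
    ‖direction r z x‖ ≤ nearest r z x := by
  rw [direction, norm_smul, norm_div, norm_norm, Real.norm_of_nonneg (nearest_nonneg r z x)]
  rw [div_mul_eq_mul_div]
  exact div_le_of_le_mul₀ (norm_nonneg _) (nearest_nonneg _ _ _) le_rfl

lemma norm_direction_le_one (r : Fin k) (z : E) (x : Centers E k) : ‖direction r z x‖ ≤ 1 :=
  (norm_direction_le r z x).trans (nearest_le_one r z x)

lemma measurable_direction [MeasurableSpace E] [BorelSpace E] [SecondCountableTopology E]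
    (r : Fin k) : Measurable fun p : E × Centers E k => direction r p.1 p.2 := by
  unfold direction
  have h : Measurable fun p : E × Centers E k => p.2 r - p.1 := by fun_prop
  exact ((measurable_nearest r).div h.norm).smul h

/-- This is `2 ‖y‖ ‖y + h‖ ≤ ‖y + h‖² + ‖y‖²` with the square expanded. The remainder carries the
inverse distance that (H1c) controls in mean. -/
lemma norm_add_le_of_inner {y : E} (hy : y ≠ 0) (h : E) :
    ‖y + h‖ ≤ ‖y‖ + inner ℝ y h / ‖y‖ + ‖h‖ ^ 2 / (2 * ‖y‖) := by
  have hy' : 0 < ‖y‖ := norm_pos_iff.2 hy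
  have h1 := norm_add_sq_real y h
  have h2 : ‖y‖ + inner ℝ y h / ‖y‖ + ‖h‖ ^ 2 / (2 * ‖y‖) =
      (‖y + h‖ ^ 2 + ‖y‖ ^ 2) / (2 * ‖y‖) := by
    rw [h1]; field_simp; ring
  rw [h2, le_div_iff₀ (by positivity)]
  nlinarith [sq_nonneg (‖y + h‖ - ‖y‖)]

/-- On the cell of `r`, expanding `‖z - x r‖² ≤ ‖z - x s‖²` bounds `⟪x r - z, x r - x s⟫` by half
the squared gap. The bound is one-sided and becomes almost a sign condition when the two centres
merge. -/
lemma inner_direction_le {r s : Fin k} {x : Centers E k} (z : E) :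
    inner ℝ (direction r z x) (x r - x s) ≤ ‖x r - x s‖ ^ 2 / 2 * ‖z - x r‖⁻¹ := by
  rcases nearest_eq_zero_or r z x with h | ⟨h, hmin⟩
  · rw [direction, h]
    simp only [zero_div, zero_smul, inner_zero_left]
    positivity
  · rw [direction, h, inner_smul_left, norm_sub_rev (x r) z]
    simp only [one_div, conj_trivial]
    rw [mul_comm]
    refine mul_le_mul_of_nonneg_right ?_ (by positivity)
    have h1 := norm_sub_sq_real (x r - z) (x r - x s)
    have h2 : x r - z - (x r - x s) = -(z - x s) := by abel
    rw [h2, norm_neg, norm_sub_rev (x r) z] at h1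
    have h3 : ‖z - x r‖ ^ 2 ≤ ‖z - x s‖ ^ 2 := by gcongr; exact hmin s
    linarith

/-- Away from ties the cell indicator is locally constant in the centres, because strict comparisons
of distances are open conditions. -/
lemma continuousAt_direction {r : Fin k} {z : E} {y : Centers E k} (hz : z ≠ y r)
    (h : nearest r z y = 0 ∨ ∀ s, s ≠ r → ‖z - y r‖ ≠ ‖z - y s‖) :
    ContinuousAt (fun x => direction r z x) y := by
  rcases nearest_eq_zero_or r z y with h0 | ⟨h1, hmin⟩
  · obtain ⟨j, hj⟩ : ∃ j, ‖z - y j‖ < ‖z - y r‖ := by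
      by_contra! hcon
      rw [nearest_eq_one hcon] at h0
      exact one_ne_zero h0
    refine (continuousAt_const (y := (0 : E))).congr ?_
    filter_upwards [eventually_apply_lt hj] with x hx
    rw [direction, nearest_eq_zero hx, zero_div, zero_smul]
  · have h2 : ∀ s, s ≠ r → ‖z - y r‖ ≠ ‖z - y s‖ := by
      rcases h with h | h
      · rw [h1] at h; norm_num at h
      · exact h
    have hc : Continuous fun x : Centers E k => x r - z := by fun_prop
    have hca : ContinuousAt (fun x : Centers E k => (1 / ‖x r - z‖) • (x r - z)) y :=
      (continuousAt_const.div hc.norm.continuousAt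
        (norm_ne_zero_iff.2 (sub_ne_zero.2 hz.symm))).smul hc.continuousAt
    refine hca.congr ?_
    have hev : ∀ᶠ x : Centers E k in 𝓝 y, ∀ s, ‖z - x r‖ ≤ ‖z - x s‖ := by
      refine eventually_all.2 fun s => ?_
      by_cases hs : s = r
      · simp [hs]
      · exact (eventually_apply_lt (lt_of_le_of_ne (hmin s) (h2 s hs))).mono fun x hx => hx.le
    filter_upwards [hev] with x hx
    rw [direction, nearest_eq_one hx]

/-- A step that does not pass `z` ends on the segment from `x r` to `z`; one that does ends at
distance `b - ‖x r - z‖ ≤ 1 / 2` beyond `z`. The ball of radius `K + 1 / 2` is therefore invariant.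
-/
lemma norm_sub_smul_direction_le {r : Fin k} {z : E} {x : Centers E k} {K b : ℝ}
    (hz : ‖z‖ ≤ K) (hx : ‖x r‖ ≤ K + 1 / 2) (hb0 : 0 < b) (hb : b ≤ 1 / 2) :
    ‖x r - b • direction r z x‖ ≤ K + 1 / 2 := by
  rcases nearest_eq_zero_or r z x with h | ⟨h, -⟩
  · rw [direction, h, zero_div, zero_smul, smul_zero, sub_zero]
    exact hx
  · rcases eq_or_ne (x r) z with hxz | hxz
    · rw [direction, hxz, sub_self, smul_zero, smul_zero, sub_zero, ← hxz]
      exact hx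
    set ρ := ‖x r - z‖
    have hρ : 0 < ρ := norm_pos_iff.2 (sub_ne_zero.2 hxz)
    have hdir : b • direction r z x = (b / ρ) • (x r - z) := by
      rw [direction, h, smul_smul, mul_one_div]
    rw [hdir]
    have ht : 0 < b / ρ := by positivity
    rcases le_total b ρ with hbρ | hbρ
    · have ht1 : b / ρ ≤ 1 := (div_le_one hρ).2 hbρ
      have heq : x r - (b / ρ) • (x r - z) = (1 - b / ρ) • x r + (b / ρ) • z := by module
      rw [heq]
      refine (norm_add_le _ _).trans ?_
      rw [norm_smul, norm_smul, Real.norm_of_nonneg ht.le, Real.norm_of_nonneg (by linarith)]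
      have h1 := mul_le_mul_of_nonneg_left hx (by linarith : 0 ≤ 1 - b / ρ)
      have h2 := mul_le_mul_of_nonneg_left hz ht.le
      linarith
    · have ht1 : 1 ≤ b / ρ := (one_le_div hρ).2 hbρ
      have heq : x r - (b / ρ) • (x r - z) = z - (b / ρ - 1) • (x r - z) := by module
      rw [heq]
      refine (norm_sub_le _ _).trans ?_
      rw [norm_smul, Real.norm_of_nonneg (by linarith)]
      have h1 : (b / ρ - 1) * ρ = b - ρ := by field_simp
      change ‖z‖ + (b / ρ - 1) * ρ ≤ _
      rw [h1]
      linarith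

end Nearest

/-! ### Null sets and the lower bound on the dimension -/

section NullSets

lemma nontrivial_of_lintegral_lt {E : Type*} [NormedAddCommGroup E] [MeasurableSpace E]
    {ν : Measure E} [IsProbabilityMeasure ν] {C : ℝ}
    (h : ∫⁻ z, ‖z - 0‖ₑ⁻¹ ∂ν < ENNReal.ofReal C) : Nontrivial E := by
  by_contra hE
  rw [not_nontrivial_iff_subsingleton] at hE
  have : ∀ z : E, ‖z - 0‖ₑ⁻¹ = ∞ := fun z => by simp [Subsingleton.elim z 0]
  rw [lintegral_congr this, lintegral_const, measure_univ, mul_one] at h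
  exact not_top_lt h

variable {E : Type*} [NormedAddCommGroup E] [InnerProductSpace ℝ E] [FiniteDimensional ℝ E]
  [MeasurableSpace E] [BorelSpace E] {ν : Measure E}

lemma ae_inner_ne (hν : ν ≪ volume) {u : E} (hu : u ≠ 0) (c : ℝ) :
    ∀ᵐ z ∂ν, inner ℝ u z ≠ c := by
  refine hν.ae_le ?_
  have hu' : inner ℝ u u ≠ 0 := inner_self_ne_zero.2 hu
  set p : E := (c / inner ℝ u u) • u
  have hp : inner ℝ u p = c := by
    simp only [p, inner_smul_right]; field_simp
  set s : AffineSubspace ℝ E := AffineSubspace.mk' p (ℝ ∙ u)ᗮ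
  have hs : ∀ z, z ∈ s ↔ inner ℝ u z = c := fun z => by
    rw [AffineSubspace.mem_mk', vsub_eq_sub, Submodule.mem_orthogonal_singleton_iff_inner_right,
      inner_sub_right, hp, sub_eq_zero]
  have htop : s ≠ ⊤ := fun h => by
    have h1 : p + u ∈ s := h ▸ AffineSubspace.mem_top ℝ E _
    rw [hs, inner_add_right, hp] at h1
    exact hu' (by linarith)
  have h0 := Measure.addHaar_affineSubspace (volume : Measure E) s htop
  have : (s : Set E) = {z | ¬ inner ℝ u z ≠ c} := by
    ext z; simp [hs]
  rw [this] at h0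
  exact h0

lemma ae_norm_sub_ne (hν : ν ≪ volume) {x y : E} (hxy : x ≠ y) :
    ∀ᵐ z ∂ν, ‖z - x‖ ≠ ‖z - y‖ := by
  filter_upwards [ae_inner_ne hν (sub_ne_zero.2 hxy) ((‖x‖ ^ 2 - ‖y‖ ^ 2) / 2)] with z hz h
  apply hz
  have h1 := norm_sub_sq_real z x
  have h2 := norm_sub_sq_real z y
  rw [h] at h1
  rw [inner_sub_left, real_inner_comm, real_inner_comm z y]
  linarith

lemma ae_ne [Nontrivial E] (hν : ν ≪ volume) (x : E) : ∀ᵐ z ∂ν, z ≠ x :=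
  hν.ae_le (Measure.ae_ne volume x)

lemma ae_notMem_line (hν : ν ≪ volume) (hd : 2 ≤ Module.finrank ℝ E) (x y : E) :
    ∀ᵐ z ∂ν, ∀ t : ℝ, z ≠ x + t • (y - x) := by
  refine hν.ae_le ?_
  have htop : AffineSubspace.mk' x (ℝ ∙ (y - x)) ≠ ⊤ := fun h => by
    have h1 : (AffineSubspace.mk' x (ℝ ∙ (y - x))).direction = ⊤ := by
      rw [h]; exact AffineSubspace.direction_top ℝ E E
    rw [AffineSubspace.direction_mk'] at h1
    have h2 := finrank_span_le_card (R := ℝ) ({y - x} : Set E)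
    rw [h1, finrank_top] at h2
    simp at h2
    omega
  have h0 := Measure.addHaar_affineSubspace (volume : Measure E) _ htop
  refine measure_mono_null (fun z hz => ?_) h0
  simp only [ne_eq, not_forall, not_not, Set.mem_ofPred_eq, Set.mem_compl_iff] at hz
  obtain ⟨t, rfl⟩ := hz
  simp only [SetLike.mem_coe, AffineSubspace.mem_mk', vsub_eq_sub, add_sub_cancel_left]
  exact Submodule.smul_mem _ _ (Submodule.mem_span_singleton_self _)

/-- In dimension one the radial Jacobian is constant, so finiteness would make `t⁻¹` integrable near
`0`. -/
lemma lintegral_inv_enorm_sub_eq_top (hd : Module.finrank ℝ E = 1) {z : E} {ρ : ℝ}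
    (hz : ‖z‖ < ρ) : ∫⁻ x in Metric.ball (0 : E) ρ, ‖z - x‖ₑ⁻¹ = ∞ := by
  have : Nontrivial E := Module.nontrivial_of_finrank_pos (R := ℝ) (by omega)
  set δ := ρ - ‖z‖
  have hδ : 0 < δ := sub_pos.2 hz
  by_contra hne
  set f : ℝ → ℝ := (Set.Iio δ).indicator fun t => t⁻¹
  have hf : Measurable f := measurable_inv.indicator measurableSet_Iio
  have hint : Integrable (fun x : E => f ‖x‖) := by
    refine ⟨(hf.comp measurable_norm).aestronglyMeasurable, ?_⟩
    rw [hasFiniteIntegral_iff_enorm]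
    have h1 : ∫⁻ x : E, ‖f ‖x‖‖ₑ = ∫⁻ x : E, ‖f ‖z - x‖‖ₑ :=
      ((lintegral_sub_left_eq_self (fun x : E => ‖f ‖x‖‖ₑ) z)).symm
    rw [h1, ← lintegral_indicator Metric.isOpen_ball.measurableSet] at *
    refine lt_of_le_of_lt (lintegral_mono fun x => ?_) (lt_top_iff_ne_top.2 hne)
    by_cases hx : ‖z - x‖ < δ
    · have hxb : x ∈ Metric.ball (0 : E) ρ := by
        rw [mem_ball_zero_iff]
        have := norm_sub_norm_le x z
        rw [norm_sub_rev] at this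
        simp only [δ] at hx
        linarith
      rw [Set.indicator_of_mem hxb]
      simp only [f]
      rw [Set.indicator_of_mem (by exact hx)]
      -- At `x = z` the real inverse is `0` and the extended one `∞`; only an inequality is needed.
      by_cases h0 : ‖z - x‖ = 0
      · simp [h0]
      · rw [enorm_inv h0, enorm_norm]
    · simp only [f]
      rw [Set.indicator_of_notMem (by exact hx)]
      simp
  rw [integrable_fun_norm_addHaar, hd] at hint
  simp only [tsub_self, pow_zero, one_smul] at hint
  have h2 : IntegrableOn (fun t : ℝ => t⁻¹) (Set.Ioc 0 (δ / 2)) := by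
    refine (hint.mono_set Set.Ioc_subset_Ioi_self).congr_fun (fun t ht => ?_) measurableSet_Ioc
    simp only [f]
    rw [Set.indicator_of_mem]
    have := ht.2
    simp only [Set.mem_Iio]
    linarith
  rw [← intervalIntegrable_iff_integrableOn_Ioc_of_le (by positivity)] at h2
  rw [intervalIntegrable_inv_iff] at h2
  rcases h2 with h2 | h2
  · linarith
  · exact h2 Set.left_mem_uIcc

/-- By Tonelli, the uniform bound integrated over `x` in the ball makes the inner integral finite
for almost every `z`; in dimension one it is infinite for every `z` in the ball. -/
lemma measure_ball_eq_zero_of_finrank_eq_one [SFinite ν] (hd : Module.finrank ℝ E = 1) {C ρ : ℝ}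
    (h : ∀ x : E, ‖x‖ ≤ ρ → ∫⁻ z, ‖z - x‖ₑ⁻¹ ∂ν < ENNReal.ofReal C) :
    ν (Metric.ball 0 ρ) = 0 := by
  have hm : Measurable fun p : E × E => ‖p.1 - p.2‖ₑ⁻¹ := by fun_prop
  have h1 : ∫⁻ z, (∫⁻ x in Metric.ball (0 : E) ρ, ‖z - x‖ₑ⁻¹) ∂ν < ∞ := by
    rw [lintegral_lintegral_swap hm.aemeasurable]
    refine lt_of_le_of_lt (setLIntegral_mono (g := fun _ => ENNReal.ofReal C) measurable_const
      fun x hx => (h x (mem_ball_zero_iff.1 hx).le).le) ?_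
    rw [setLIntegral_const]
    exact ENNReal.mul_lt_top ENNReal.ofReal_lt_top Metric.isBounded_ball.measure_lt_top
  have h2 := ae_lt_top (hm.lintegral_prod_right' (ν := volume.restrict (Metric.ball 0 ρ))) h1.ne
  rw [ae_iff] at h2
  refine measure_mono_null (fun z hz => ?_) h2
  simp only [Set.mem_ofPred_eq, not_lt, top_le_iff]
  exact lintegral_inv_enorm_sub_eq_top hd (mem_ball_zero_iff.1 hz)

lemma two_le_finrank [IsProbabilityMeasure ν] {K C : ℝ} (hK : 0 < K)
    (H1c : ∀ x : E, ‖x‖ ≤ K + 1 → ∫⁻ z, ‖z - x‖ₑ⁻¹ ∂ν < ENNReal.ofReal C)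
    (h : (∀ᵐ z ∂ν, ‖z‖ ≤ K) ∨ ∀ x : E, ∫⁻ z, ‖z - x‖ₑ⁻¹ ∂ν < ENNReal.ofReal C) :
    2 ≤ Module.finrank ℝ E := by
  have := nontrivial_of_lintegral_lt (H1c 0 (by simp; linarith))
  have hpos : 0 < Module.finrank ℝ E := Module.finrank_pos
  by_contra hd
  have hd1 : Module.finrank ℝ E = 1 := by omega
  have huniv : ν Set.univ = 0 := by
    rcases h with h | h
    · rw [← measure_ball_eq_zero_of_finrank_eq_one hd1 H1c]
      refine measure_congr ?_
      filter_upwards [h] with z hz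
      exact propext ⟨fun _ => mem_ball_zero_iff.2 (by linarith), fun _ => trivial⟩
    · rw [← Metric.iUnion_ball_nat (0 : E), measure_iUnion_null_iff]
      exact fun n => measure_ball_eq_zero_of_finrank_eq_one hd1 fun x _ => h x
  simp at huniv

end NullSets

/-! ### The objective, its gradient and merging centres -/

section Gradient

variable {E : Type*} [NormedAddCommGroup E] [MeasurableSpace E] {k : ℕ}

/-- The probability that the `r`-th centre is a nearest one. -/
def nearestProb (ν : Measure E) (r : Fin k) (x : Centers E k) : ℝ := ∫ z, nearest r z x ∂ν

variable {ν : Measure E}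

lemma nearestProb_nonneg (r : Fin k) (x : Centers E k) : 0 ≤ nearestProb ν r x :=
  integral_nonneg fun z => nearest_nonneg r z x

lemma objective_nonneg (x : Centers E k) : 0 ≤ objective ν x :=
  integral_nonneg fun z => iInf_norm_sub_nonneg z x

variable [BorelSpace E]

lemma integrable_inv_norm_sub {C : ℝ} {x : E} (h : ∫⁻ z, ‖z - x‖ₑ⁻¹ ∂ν < ENNReal.ofReal C) :
    Integrable (fun z => ‖z - x‖⁻¹) ν ∧ ∫ z, ‖z - x‖⁻¹ ∂ν ≤ C := by
  have hC : 0 ≤ C := by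
    by_contra hC
    rw [ENNReal.ofReal_of_nonpos (by linarith)] at h
    exact not_lt_zero h
  have hm : Measurable fun z : E => ‖z - x‖⁻¹ := by fun_prop
  have hle : ∀ z : E, ‖(‖z - x‖⁻¹ : ℝ)‖ₑ ≤ ‖z - x‖ₑ⁻¹ := fun z => by
    by_cases h0 : ‖z - x‖ = 0
    · simp [h0]
    · rw [enorm_inv h0, enorm_norm]
  have hlt := (lintegral_mono hle).trans_lt h
  refine ⟨⟨hm.aestronglyMeasurable, hlt.trans ENNReal.ofReal_lt_top⟩, ?_⟩
  refine (le_abs_self _).trans ?_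
  rw [← Real.norm_eq_abs, ← ENNReal.ofReal_le_ofReal_iff hC, ofReal_norm]
  exact (enorm_integral_le_lintegral_enorm _).trans hlt.le

variable [InnerProductSpace ℝ E] [FiniteDimensional ℝ E]

lemma integrable_nearest [IsFiniteMeasure ν] (r : Fin k) (x : Centers E k) :
    Integrable (fun z => nearest r z x) ν :=
  .of_bound ((measurable_nearest r).comp measurable_prodMk_right).aestronglyMeasurable 1
    (Eventually.of_forall fun z => abs_nearest_le_one r z x)

lemma integrable_direction [IsFiniteMeasure ν] (r : Fin k) (x : Centers E k) :
    Integrable (fun z => direction r z x) ν :=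
  .of_bound ((measurable_direction r).comp measurable_prodMk_right).aestronglyMeasurable 1
    (Eventually.of_forall fun z => norm_direction_le_one r z x)

lemma measurable_direction_comp {α : Type*} {m : MeasurableSpace α} {Z : α → E}
    {X : α → Centers E k} (hZ : Measurable Z) (hX : Measurable X) (r : Fin k) :
    Measurable fun ω => direction r (Z ω) (X ω) := by
  have h := (measurable_direction r).comp (hZ.prodMk hX)
  exact h

lemma nearestProb_le_one [IsProbabilityMeasure ν] (r : Fin k) (x : Centers E k) :
    nearestProb ν r x ≤ 1 := by
  simpa [nearestProb] using integral_mono (μ := ν) (integrable_nearest r x) (integrable_const 1)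
    fun z => nearest_le_one r z x

lemma one_le_sum_nearestProb [IsProbabilityMeasure ν] (hk : 1 ≤ k) (x : Centers E k) :
    1 ≤ ∑ r, nearestProb ν r x := by
  simp only [nearestProb]
  rw [← integral_finsetSum _ fun r _ => integrable_nearest r x]
  simpa using integral_mono (μ := ν) (integrable_const 1)
    (integrable_finsetSum _ fun r _ => integrable_nearest r x)
    fun z => one_le_sum_nearest hk z x

lemma norm_grad_apply_le [IsFiniteMeasure ν] (r : Fin k) (x : Centers E k) :
    ‖grad ν x r‖ ≤ nearestProb ν r x :=
  (norm_integral_le_integral_norm _).trans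
    (integral_mono (integrable_direction r x).norm (integrable_nearest r x)
      fun z => norm_direction_le r z x)

lemma inner_grad_apply [IsFiniteMeasure ν] (r : Fin k) (x : Centers E k) (v : E) :
    inner ℝ (grad ν x r) v = ∫ z, inner ℝ (direction r z x) v ∂ν := by
  rw [real_inner_comm]
  simp only [fun z => real_inner_comm v (direction r z x)]
  exact (integral_inner (integrable_direction r x) v).symm

lemma measurable_iInf_norm_sub :
    Measurable fun p : E × Centers E k => ⨅ r, ‖p.1 - p.2 r‖ := by
  refine Measurable.iInf fun r => ?_
  have h : Measurable fun p : E × Centers E k => p.1 - p.2 r := by fun_prop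
  exact h.norm

lemma integrable_iInf_norm_sub [IsFiniteMeasure ν] (hk : 1 ≤ k)
    (hν : Integrable (fun z : E => z) ν) (x : Centers E k) :
    Integrable (fun z => ⨅ r, ‖z - x r‖) ν := by
  have h1 : Integrable (fun z => ‖z - x ⟨0, hk⟩‖) ν := (hν.sub (integrable_const _)).norm
  refine h1.mono' (measurable_iInf_norm_sub.comp measurable_prodMk_right).aestronglyMeasurable
    (Eventually.of_forall fun z => ?_)
  rw [Real.norm_of_nonneg (iInf_norm_sub_nonneg z x)]
  exact iInf_norm_sub_le _ z x

lemma objective_le_add [IsProbabilityMeasure ν] (hν : Integrable (fun z : E => z) ν)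
    (r : Fin k) (x : Centers E k) : objective ν x ≤ ∫ z, ‖z‖ ∂ν + ‖x r‖ := by
  have h1 := integral_mono (μ := ν)
    (integrable_iInf_norm_sub (Nat.one_le_of_lt r.pos) hν x)
    (hν.norm.add (integrable_const ‖x r‖))
    fun z => (iInf_norm_sub_le r z x).trans (norm_sub_le _ _)
  simpa [objective, integral_add hν.norm (integrable_const _)] using h1

lemma measurable_objective [SFinite ν] : Measurable (objective ν : Centers E k → ℝ) :=
  (measurable_iInf_norm_sub.comp measurable_swap).stronglyMeasurable.integral_prod_right'.measurable

lemma measurable_nearestProb [SFinite ν] (r : Fin k) :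
    Measurable (nearestProb ν r : Centers E k → ℝ) :=
  ((measurable_nearest r).comp measurable_swap).stronglyMeasurable.integral_prod_right'.measurable

lemma measurable_grad_apply [SFinite ν] (r : Fin k) :
    Measurable fun x : Centers E k => grad ν x r :=
  ((measurable_direction r).comp measurable_swap).stronglyMeasurable.integral_prod_right'.measurable

/-- A quadratic upper bound for the objective at a system of distinct centres. -/
lemma objective_le [IsProbabilityMeasure ν] [Nontrivial E] (hk : 1 ≤ k) (hac : ν ≪ volume)
    (hν : Integrable (fun z : E => z) ν) {C : ℝ} {x : Centers E k}
    (hx : Function.Injective fun r => x r)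
    (hC : ∀ r, ∫⁻ z, ‖z - x r‖ₑ⁻¹ ∂ν < ENNReal.ofReal C) (y : Centers E k) :
    objective ν y ≤ objective ν x + ∑ r, inner ℝ (grad ν x r) (y r - x r) +
      C / 2 * ∑ r, ‖y r - x r‖ ^ 2 := by
  have hne : ∀ᵐ z ∂ν, ∀ r, z ≠ x r := ae_all_iff.2 fun r => ae_ne hac _
  have hties : ∀ᵐ z ∂ν, ∀ r s, r ≠ s → ‖z - x r‖ ≠ ‖z - x s‖ := by
    refine ae_all_iff.2 fun r => ae_all_iff.2 fun s => ?_
    by_cases hrs : r = s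
    · simp [hrs]
    · filter_upwards [ae_norm_sub_ne hac (hx.ne hrs)] with z hz _ using hz
  have hpt : ∀ᵐ z ∂ν, (⨅ r, ‖z - y r‖) ≤ (⨅ r, ‖z - x r‖) +
      (∑ r, inner ℝ (direction r z x) (y r - x r) +
        ∑ r, ‖y r - x r‖ ^ 2 / 2 * ‖z - x r‖⁻¹) := by
    filter_upwards [hne, hties] with z hz hzt
    -- Without ties only the nearest centre `r` contributes to the first-order sum, and the other
    -- second-order terms are nonnegative. The objective at `y` is then bounded through the same
    -- index `r`.
    obtain ⟨r, hr⟩ := exists_nearest_eq_one hk z x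
    have hmin : ∀ j, ‖z - x r‖ ≤ ‖z - x j‖ := by
      rcases nearest_eq_zero_or r z x with h | ⟨-, h⟩
      · rw [h] at hr; norm_num at hr
      · exact h
    have h1 : ∑ s, inner ℝ (direction s z x) (y s - x s) =
        inner ℝ (x r - z) (y r - x r) / ‖x r - z‖ := by
      rw [Finset.sum_eq_single r]
      · rw [direction, hr, inner_smul_left]
        simp; ring
      · intro s _ hs
        rw [direction, nearest_eq_zero (lt_of_le_of_ne (hmin s) (hzt r s hs.symm))]
        simp
      · simp
    have h2 : ‖y r - x r‖ ^ 2 / 2 * ‖z - x r‖⁻¹ ≤ ∑ s, ‖y s - x s‖ ^ 2 / 2 * ‖z - x s‖⁻¹ :=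
      Finset.single_le_sum (f := fun s => ‖y s - x s‖ ^ 2 / 2 * ‖z - x s‖⁻¹)
        (fun s _ => by positivity) (Finset.mem_univ r)
    have h3 := norm_add_le_of_inner (sub_ne_zero.2 (hz r).symm) (y r - x r)
    have h4 : x r - z + (y r - x r) = y r - z := by abel
    have h5 : ‖y r - x r‖ ^ 2 / (2 * ‖x r - z‖) = ‖y r - x r‖ ^ 2 / 2 * ‖z - x r‖⁻¹ := by
      rw [norm_sub_rev (x r) z, ← div_div, div_eq_mul_inv _ ‖z - x r‖]
    rw [h4, h5, ← h1, norm_sub_rev (y r) z, norm_sub_rev (x r) z] at h3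
    rw [iInf_norm_sub_eq hr]
    linarith [iInf_norm_sub_le r z y]
  have hi1 : ∀ r ∈ Finset.univ, Integrable (fun z => inner ℝ (direction r z x) (y r - x r)) ν :=
    fun r _ => (integrable_direction r x).inner_const _
  have hi2 : ∀ r ∈ Finset.univ, Integrable (fun z => ‖y r - x r‖ ^ 2 / 2 * ‖z - x r‖⁻¹) ν :=
    fun r _ => (integrable_inv_norm_sub (hC r)).1.const_mul _
  have hs1 := integrable_finsetSum _ hi1
  have hs2 := integrable_finsetSum _ hi2
  have hs12 : Integrable (fun z => ∑ r, inner ℝ (direction r z x) (y r - x r) +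
      ∑ r, ‖y r - x r‖ ^ 2 / 2 * ‖z - x r‖⁻¹) ν := hs1.add hs2
  have h := integral_mono_ae (integrable_iInf_norm_sub hk hν y)
    ((integrable_iInf_norm_sub hk hν x).add hs12) hpt
  simp only [Pi.add_apply] at h
  rw [integral_add (integrable_iInf_norm_sub hk hν x) hs12, integral_add hs1 hs2,
    integral_finsetSum _ hi1, integral_finsetSum _ hi2] at h
  simp only [← inner_grad_apply] at h
  have h6 : ∑ r, ∫ z, ‖y r - x r‖ ^ 2 / 2 * ‖z - x r‖⁻¹ ∂ν ≤ C / 2 * ∑ r, ‖y r - x r‖ ^ 2 := by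
    rw [Finset.mul_sum]
    refine Finset.sum_le_sum fun r _ => ?_
    rw [integral_const_mul]
    have := mul_le_mul_of_nonneg_left (integrable_inv_norm_sub (hC r)).2
      (by positivity : 0 ≤ ‖y r - x r‖ ^ 2 / 2)
    linarith
  simp only [objective]
  linarith

/-- The one-sided bound `t ≤ (δ / 2) / ‖z - x r‖` gives `|t| ≤ δ / ‖z - x r‖ - t`, and the mean of
`t` is at most the gradient norm in absolute value. -/
lemma integral_abs_inner_direction_le [IsFiniteMeasure ν] {C : ℝ} {r s : Fin k}
    {x : Centers E k} (hrs : x r ≠ x s) (hC : ∫⁻ z, ‖z - x r‖ₑ⁻¹ ∂ν < ENNReal.ofReal C) :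
    ∫ z, |inner ℝ (direction r z x) (‖x r - x s‖⁻¹ • (x r - x s))| ∂ν ≤
      ‖grad ν x r‖ + ‖x r - x s‖ * C := by
  set δ := ‖x r - x s‖
  have hδ : 0 < δ := norm_pos_iff.2 (sub_ne_zero.2 hrs)
  set u := δ⁻¹ • (x r - x s)
  have hu : ‖u‖ = 1 := by
    simp only [u, norm_smul, norm_inv, δ, norm_norm]
    exact inv_mul_cancel₀ hδ.ne'
  obtain ⟨hi, hle⟩ := integrable_inv_norm_sub hC
  have hi' : Integrable (fun z => inner ℝ (direction r z x) u) ν :=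
    (integrable_direction r x).inner_const _
  have hpt : ∀ z, |inner ℝ (direction r z x) u| ≤
      δ * ‖z - x r‖⁻¹ - inner ℝ (direction r z x) u := fun z => by
    have h1 : inner ℝ (direction r z x) u ≤ δ / 2 * ‖z - x r‖⁻¹ := by
      simp only [u]
      rw [inner_smul_right, inv_mul_le_iff₀ hδ]
      refine (inner_direction_le z).trans (le_of_eq ?_)
      simp only [δ]; ring
    have h2 : 0 ≤ δ * ‖z - x r‖⁻¹ := by positivity
    rw [abs_le]
    constructor <;> linarith
  have h := integral_mono hi'.abs ((hi.const_mul δ).sub hi') hpt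
  simp only [Pi.sub_apply] at h
  rw [integral_sub (hi.const_mul δ) hi', integral_const_mul, ← inner_grad_apply] at h
  have h3 := neg_le_of_abs_le (abs_real_inner_le_norm (grad ν x r) u)
  rw [hu, mul_one] at h3
  have h4 := mul_le_mul_of_nonneg_left hle hδ.le
  linarith

/-- When two centres merge while the corresponding gradient vanishes, the cell of the first one
becomes negligible. -/
lemma tendsto_nearestProb_of_merge [IsProbabilityMeasure ν] [Nontrivial E] (hac : ν ≪ volume)
    {C : ℝ} {r s : Fin k} {x : ℕ → Centers E k} {p : E} (hrs : ∀ n, x n r ≠ x n s)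
    (hC : ∀ n, ∫⁻ z, ‖z - x n r‖ₑ⁻¹ ∂ν < ENNReal.ofReal C)
    (hr : Tendsto (fun n => x n r) atTop (𝓝 p)) (hs : Tendsto (fun n => x n s) atTop (𝓝 p))
    (hg : Tendsto (fun n => grad ν (x n) r) atTop (𝓝 0)) :
    Tendsto (fun n => nearestProb ν r (x n)) atTop (𝓝 0) := by
  set u : ℕ → E := fun n => ‖x n r - x n s‖⁻¹ • (x n r - x n s)
  have hu : ∀ n, u n ∈ Metric.sphere (0 : E) 1 := fun n => by
    have h0 : ‖x n r - x n s‖ ≠ 0 := norm_ne_zero_iff.2 (sub_ne_zero.2 (hrs n))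
    simp only [u, mem_sphere_zero_iff_norm, norm_smul, norm_inv, norm_norm]
    exact inv_mul_cancel₀ h0
  have hL1 : Tendsto (fun n => ∫ z, |inner ℝ (direction r z (x n)) (u n)| ∂ν) atTop (𝓝 0) := by
    refine squeeze_zero (fun n => integral_nonneg fun z => abs_nonneg _)
      (fun n => integral_abs_inner_direction_le (hrs n) (hC n)) ?_
    have h1 := (hr.sub hs).norm.mul_const C
    simpa using hg.norm.add h1
  -- The axis `u n` need not converge; passing to subsequences gives it a limit `v` by compactness
  -- of the sphere, and then turns `L¹` convergence into almost sure convergence.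
  refine tendsto_of_subseq_tendsto fun ns hns => ?_
  obtain ⟨v, hv, φ, hφ, hφv⟩ := (isCompact_sphere (0 : E) 1).tendsto_subseq fun n => hu (ns n)
  have hv0 : v ≠ 0 := by
    rintro rfl
    simp at hv
  have hns' : Tendsto (fun n => ns (φ n)) atTop atTop := hns.comp hφ.tendsto_atTop
  set F : ℕ → E → ℝ := fun n z => inner ℝ (direction r z (x (ns (φ n)))) (u (ns (φ n)))
  have hFi : ∀ n, Integrable (F n) ν := fun n => (integrable_direction r _).inner_const _
  have hmeas : TendstoInMeasure ν F atTop 0 := by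
    refine tendstoInMeasure_of_tendsto_eLpNorm one_ne_zero (fun n => (hFi n).1)
      aestronglyMeasurable_zero ?_
    have h1 := ENNReal.tendsto_ofReal (hL1.comp hns')
    rw [ENNReal.ofReal_zero] at h1
    refine h1.congr fun n => ?_
    rw [sub_zero, eLpNorm_one_eq_lintegral_enorm, ← ofReal_integral_norm_eq_lintegral_enorm (hFi n)]
    rfl
  obtain ⟨ψ, hψ, hae⟩ := hmeas.exists_seq_tendsto_ae
  refine ⟨fun n => φ (ψ n), ?_⟩
  have hns'' : Tendsto (fun n => ns (φ (ψ n))) atTop atTop := hns'.comp hψ.tendsto_atTop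
  have hlim : ∀ᵐ z ∂ν, Tendsto (fun n => nearest r z (x (ns (φ (ψ n))))) atTop (𝓝 0) := by
    filter_upwards [hae, ae_inner_ne hac hv0 (inner ℝ v p), ae_ne hac p] with z hz hzv hzp
    have hpz : p - z ≠ 0 := sub_ne_zero.2 hzp.symm
    have h1 : Tendsto (fun n => x (ns (φ (ψ n))) r - z) atTop (𝓝 (p - z)) :=
      (hr.comp hns'').sub_const z
    have h2 : Tendsto (fun n => u (ns (φ (ψ n)))) atTop (𝓝 v) := hφv.comp hψ.tendsto_atTop
    have h3 := (h1.inner h2).div h1.norm (norm_ne_zero_iff.2 hpz)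
    have hne : inner ℝ (p - z) v / ‖p - z‖ ≠ 0 := by
      refine div_ne_zero (fun h => hzv ?_) (norm_ne_zero_iff.2 hpz)
      rw [real_inner_comm, inner_sub_right] at h
      linarith
    -- The component is the indicator times a factor with nonzero limit, so dividing that factor out
    -- leaves the indicator.
    have h4 := hz.div h3 hne
    simp only [Pi.zero_apply, zero_div] at h4
    refine h4.congr' ?_
    filter_upwards [h3.eventually_ne hne] with n hn
    rw [Pi.div_apply, div_eq_iff hn]
    simp only [F, direction, inner_smul_left, conj_trivial, Pi.div_apply]
    ring
  have h := tendsto_integral_of_dominated_convergence (fun _ => (1 : ℝ))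
    (fun n => (integrable_nearest r (x (ns (φ (ψ n))))).1) (integrable_const _)
    (fun n => Eventually.of_forall fun z => abs_nearest_le_one r z _) hlim
  simpa [nearestProb] using h

lemma ae_norm_sub_apply_ne (hac : ν ≪ volume) (y : Centers E k) (r : Fin k) :
    ∀ᵐ z ∂ν, ∀ s, y r ≠ y s → ‖z - y r‖ ≠ ‖z - y s‖ := by
  refine ae_all_iff.2 fun s => ?_
  by_cases h : y r = y s
  · simp [h]
  · filter_upwards [ae_norm_sub_ne hac h] with z hz _ using hz

/-- If the cells of all centres merging with the `r`-th one become negligible, then so is the cell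
of their limit. -/
lemma nearestProb_eq_zero_of_tendsto [IsProbabilityMeasure ν] (hac : ν ≪ volume) (hk : 1 ≤ k)
    {r : Fin k} {x : ℕ → Centers E k} {y : Centers E k} (hx : Tendsto x atTop (𝓝 y))
    (h : ∀ s, y r = y s → Tendsto (fun n => nearestProb ν s (x n)) atTop (𝓝 0)) :
    nearestProb ν r y = 0 := by
  classical
  refine le_antisymm ?_ (nearestProb_nonneg r y)
  -- `∑ G` dominates the limiting cell indicator, since the cells of `x n` cover the space. Centres
  -- merging with `r` contribute cells of vanishing mass; any other centre is eventually strictly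
  -- farther from almost every point of the limiting cell.
  set G : ℕ → Fin k → E → ℝ := fun n s z =>
    if y r = y s then nearest s z (x n) else nearest s z (x n) * nearest r z y
  have hGi : ∀ n s, Integrable (G n s) ν := fun n s => by
    by_cases hs : y r = y s
    · simpa [G, hs] using integrable_nearest s (x n)
    · simp only [G, if_neg hs]
      exact (integrable_nearest s (x n)).mul_bdd (c := 1) (integrable_nearest r y).1
        (Eventually.of_forall fun z => abs_nearest_le_one r z y)
  have hG : ∀ s, Tendsto (fun n => ∫ z, G n s z ∂ν) atTop (𝓝 0) := fun s => by
    by_cases hs : y r = y s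
    · simpa [G, hs, nearestProb] using h s hs
    · have h1 := tendsto_integral_of_dominated_convergence (μ := ν) (F := fun n => G n s)
        (f := fun _ => 0) (fun _ => (1 : ℝ)) (fun n => (hGi n s).1) (integrable_const _)
        (fun n => Eventually.of_forall fun z => ?_) ?_
      · simpa using h1
      · simp only [G, if_neg hs, norm_mul, Real.norm_eq_abs]
        exact mul_le_one₀ (abs_nearest_le_one _ _ _) (abs_nonneg _) (abs_nearest_le_one _ _ _)
      · filter_upwards [ae_norm_sub_apply_ne hac y r] with z hz
        simp only [G, if_neg hs]
        rcases nearest_eq_zero_or r z y with h0 | ⟨-, hmin⟩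
        · simp [h0]
        · refine tendsto_const_nhds.congr' ?_
          filter_upwards [hx.eventually (eventually_apply_lt
            (lt_of_le_of_ne (hmin s) (hz s hs)))] with n hn
          rw [nearest_eq_zero hn, zero_mul]
  have hsum : Tendsto (fun n => ∑ s, ∫ z, G n s z ∂ν) atTop (𝓝 0) := by
    simpa using tendsto_finsetSum Finset.univ fun s _ => hG s
  refine ge_of_tendsto' hsum fun n => ?_
  rw [← integral_finsetSum _ fun s _ => hGi n s]
  refine integral_mono (integrable_nearest r y) (integrable_finsetSum _ fun s _ => hGi n s)
    fun z => ?_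
  have h1 : ∀ s, nearest s z (x n) * nearest r z y ≤ G n s z := fun s => by
    by_cases hs : y r = y s
    · simp only [G, if_pos hs]
      exact mul_le_of_le_one_right (nearest_nonneg _ _ _) (nearest_le_one _ _ _)
    · simp only [G, if_neg hs, le_refl]
  calc nearest r z y ≤ (∑ s, nearest s z (x n)) * nearest r z y :=
        le_mul_of_one_le_left (nearest_nonneg _ _ _) (one_le_sum_nearest hk z (x n))
    _ ≤ ∑ s, G n s z := by
        rw [Finset.sum_mul]
        exact Finset.sum_le_sum fun s _ => h1 s

/-- A limit of systems of distinct centres along which the gradient tends to zero is a stationary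
point at which the gradient is continuous. -/
theorem continuousAt_grad_of_tendsto [IsProbabilityMeasure ν] [Nontrivial E] (hac : ν ≪ volume)
    (hk : 1 ≤ k) {C : ℝ} {x : ℕ → Centers E k} {y : Centers E k}
    (hinj : ∀ n, Function.Injective fun r => x n r)
    (hC : ∀ n r, ∫⁻ z, ‖z - x n r‖ₑ⁻¹ ∂ν < ENNReal.ofReal C)
    (hx : Tendsto x atTop (𝓝 y)) (hg : Tendsto (fun n => grad ν (x n)) atTop (𝓝 0)) :
    grad ν y = 0 ∧ ContinuousAt (grad ν) y := by
  have happ : ∀ r, Continuous fun x : Centers E k => x r := fun r => by fun_prop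
  have hxr : ∀ r, Tendsto (fun n => x n r) atTop (𝓝 (y r)) := fun r =>
    ((happ r).tendsto y).comp hx
  have hgr : ∀ r, Tendsto (fun n => grad ν (x n) r) atTop (𝓝 0) := fun r =>
    ((happ r).tendsto 0).comp hg
  -- Either the `r`-th limit centre is isolated from the others, so ties are null, or its cell is
  -- null; in both cases the direction is almost surely continuous at `y`.
  have hcase : ∀ r, (∀ᵐ z ∂ν, nearest r z y = 0) ∨ ∀ s, s ≠ r → y r ≠ y s := fun r => by
    by_cases hr : ∀ s, s ≠ r → y r ≠ y s
    · exact Or.inr hr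
    · push Not at hr
      obtain ⟨s, hsr, hs⟩ := hr
      refine Or.inl ?_
      have h0 : nearestProb ν r y = 0 := by
        refine nearestProb_eq_zero_of_tendsto hac hk hx fun t ht => ?_
        -- Every `t` in the cluster of `r` needs a partner to merge with: `s` when `t = r`, and `r`
        -- otherwise.
        obtain ⟨t', htt', ht'⟩ : ∃ t', t' ≠ t ∧ y t = y t' := by
          by_cases h : t = r
          · exact ⟨s, by rwa [h], by rw [h, hs]⟩
          · exact ⟨r, fun h' => h h'.symm, ht.symm⟩
        exact tendsto_nearestProb_of_merge hac (fun n => (hinj n).ne htt'.symm)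
          (fun n => hC n t) (hxr t) (ht' ▸ hxr t') (hgr t)
      exact (integral_eq_zero_iff_of_nonneg (fun z => nearest_nonneg r z y)
        (integrable_nearest r y)).1 h0
  have hcont : ∀ r, ContinuousAt (fun x => grad ν x r) y := fun r => by
    refine continuousAt_of_dominated (bound := fun _ => (1 : ℝ))
      (Eventually.of_forall fun x => (integrable_direction r x).1)
      (Eventually.of_forall fun x => Eventually.of_forall fun z => norm_direction_le_one r z x)
      (integrable_const _) ?_
    rcases hcase r with h | h
    · filter_upwards [h, ae_ne hac (y r)] with z hz hzr
      exact continuousAt_direction hzr (Or.inl hz)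
    · filter_upwards [ae_norm_sub_apply_ne hac y r, ae_ne hac (y r)] with z hz hzr
      exact continuousAt_direction hzr (Or.inr fun s hs => hz s (h s hs))
  have hzero : ∀ r, grad ν y r = 0 := fun r =>
    tendsto_nhds_unique ((hcont r).tendsto.comp hx) (hgr r)
  refine ⟨PiLp.ext hzero, ?_⟩
  exact (PiLp.continuous_toLp 2 _).continuousAt.comp (continuousAt_pi.2 hcont)

end Gradient

/-! ### Deterministic paths: excursions and convergence of the gradient -/

/-- If `d ≥ η` from `N` on, then `α ≤ η⁻² α d²` there, and `∑ α` would converge. -/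
lemma exists_lt_of_summable_mul_sq {α d : ℕ → ℝ} (hα : ∀ n, 0 ≤ α n)
    (hαs : Tendsto (fun N => ∑ n ∈ Finset.range N, α n) atTop atTop)
    (hs : Summable fun n => α n * d n ^ 2) {η : ℝ} (hη : 0 < η) (N : ℕ) :
    ∃ n, N ≤ n ∧ d n < η := by
  by_contra! hcon
  have h1 : Summable fun n => α (n + N) := by
    refine Summable.of_nonneg_of_le (fun n => hα _) (fun n => ?_)
      (((summable_nat_add_iff N).2 hs).mul_right (η ^ 2)⁻¹)
    rw [← div_eq_mul_inv, le_div_iff₀ (by positivity)]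
    refine mul_le_mul_of_nonneg_left ?_ (hα _)
    have := hcon (n + N) (by omega)
    gcongr
  exact not_tendsto_nhds_of_tendsto_atTop hαs _
    ((summable_nat_add_iff N).1 h1).hasSum.tendsto_sum_nat

lemma exists_last_le {d : ℕ → ℝ} {η : ℝ} {p q : ℕ} (hpq : p ≤ q) (hp : d p ≤ η) :
    ∃ m, p ≤ m ∧ m ≤ q ∧ d m ≤ η ∧ ∀ i, m < i → i ≤ q → η < d i := by
  induction q, hpq using Nat.le_induction with
  | base => exact ⟨p, le_rfl, le_rfl, hp, fun i h1 h2 => by omega⟩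
  | succ q hq ih =>
    by_cases h : d (q + 1) ≤ η
    · exact ⟨q + 1, by omega, le_rfl, h, fun i h1 h2 => by omega⟩
    · obtain ⟨m, h1, h2, h3, h4⟩ := ih
      refine ⟨m, h1, by omega, h3, fun i hi hiq => ?_⟩
      rcases Nat.lt_or_ge q i with h5 | h5
      · rw [show i = q + 1 by omega]
        exact not_le.1 h
      · exact h4 i hi h5

/-- A path with slowly summable squared speed that keeps reaching the level `ε` has arbitrarily
short excursions from arbitrarily small levels to the level `ε`. -/
lemma exists_short_excursion {F : Type*} [NormedAddCommGroup F] {X : ℕ → F} {α d : ℕ → ℝ}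
    {c : ℝ} (hc : 0 ≤ c) (hX : ∀ n, ‖X (n + 1) - X n‖ ≤ c * α n) (hα : ∀ n, 0 ≤ α n)
    (hα0 : Tendsto α atTop (𝓝 0))
    (hαs : Tendsto (fun N => ∑ n ∈ Finset.range N, α n) atTop atTop)
    (hs : Summable fun n => α n * d n ^ 2) {ε : ℝ} (hε : ∃ᶠ n in atTop, ε ≤ d n) {η : ℝ}
    (hη : 0 < η) : ∃ p q, d p ≤ η ∧ ε ≤ d q ∧ ‖X q - X p‖ ≤ η := by
  have hα' : ∀ᶠ n in atTop, c * α n < η / 2 := by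
    have h1 := hα0.const_mul c
    rw [mul_zero] at h1
    exact h1.eventually_lt_const (by positivity)
  have hcau := hs.hasSum.tendsto_sum_nat.cauchySeq
  rw [Metric.cauchySeq_iff] at hcau
  obtain ⟨N₁, hN₁⟩ := eventually_atTop.1 hα'
  -- Where `d > η`, `∑ α ≤ η⁻² ∑ α d²`, so this tolerance keeps `c ∑ α` below `η / 2`; `c + 1`
  -- avoids division by zero.
  obtain ⟨N₂, hN₂⟩ := hcau (η ^ 2 * (η / 2) / (c + 1)) (by positivity)
  obtain ⟨p₀, hp₀, hdp₀⟩ := exists_lt_of_summable_mul_sq hα hαs hs hη (max N₁ N₂)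
  obtain ⟨q, hq, hdq⟩ := frequently_atTop.1 hε p₀
  obtain ⟨p, h1, h2, h3, h4⟩ := exists_last_le hq hdp₀.le
  have hpN₁ : N₁ ≤ p := (le_max_left _ _).trans (hp₀.trans h1)
  have hpN₂ : N₂ ≤ p := (le_max_right _ _).trans (hp₀.trans h1)
  refine ⟨p, q, h3, hdq, ?_⟩
  rcases h2.eq_or_lt with rfl | hlt
  · simpa using hη.le
  have hsum : ‖X q - X p‖ ≤ ∑ i ∈ Finset.Ico p q, c * α i := by
    rw [← Finset.sum_Ico_sub _ h2]
    exact norm_sum_le_of_le _ fun i _ => hX i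
  have htail : ∑ i ∈ Finset.Ico (p + 1) q, α i * d i ^ 2 < η ^ 2 * (η / 2) / (c + 1) := by
    rw [Finset.sum_Ico_eq_sub _ (by omega)]
    exact (le_abs_self _).trans_lt (hN₂ q (by omega) (p + 1) (by omega))
  have htail' : η ^ 2 * ∑ i ∈ Finset.Ico (p + 1) q, α i ≤
      ∑ i ∈ Finset.Ico (p + 1) q, α i * d i ^ 2 := by
    rw [Finset.mul_sum]
    refine Finset.sum_le_sum fun i hi => ?_
    rw [Finset.mem_Ico] at hi
    rw [mul_comm]
    refine mul_le_mul_of_nonneg_left ?_ (hα i)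
    have := (h4 i (by omega) (by omega)).le
    gcongr
  have hS : (c + 1) * ∑ i ∈ Finset.Ico (p + 1) q, α i ≤ η / 2 := by
    have h5 := htail'.trans htail.le
    rw [le_div_iff₀ (by positivity), mul_assoc] at h5
    have h6 := le_of_mul_le_mul_left h5 (by positivity)
    linarith
  have hS0 : 0 ≤ ∑ i ∈ Finset.Ico (p + 1) q, α i := Finset.sum_nonneg fun i _ => hα i
  -- The step leaving `p` is split off because `d p ≤ η`; it costs less than `η / 2` since `α` tends
  -- to zero.
  rw [Finset.sum_eq_sum_Ico_succ_bot hlt, ← Finset.mul_sum] at hsum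
  have := hN₁ p hpN₁
  linarith

section Path

variable {E : Type*} [NormedAddCommGroup E] [InnerProductSpace ℝ E] [FiniteDimensional ℝ E]
  [MeasurableSpace E] [BorelSpace E] {k : ℕ} {ν : Measure E}

/-- A bounded path of distinct centres whose gradient is square summable along a divergent series
of steps has a vanishing gradient and approaches the stationary points. -/
theorem tendsto_grad_and_infEDist [IsProbabilityMeasure ν] [Nontrivial E] (hac : ν ≪ volume)
    (hk : 1 ≤ k) {C : ℝ} {X : ℕ → Centers E k} (hinj : ∀ n, Function.Injective fun r => X n r)
    (hC : ∀ n r, ∫⁻ z, ‖z - X n r‖ₑ⁻¹ ∂ν < ENNReal.ofReal C)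
    (hbdd : Bornology.IsBounded (Set.range X))
    {α : ℕ → ℝ} {c : ℝ} (hc : 0 ≤ c) (hX : ∀ n, ‖X (n + 1) - X n‖ ≤ c * α n)
    (hα : ∀ n, 0 ≤ α n) (hα0 : Tendsto α atTop (𝓝 0))
    (hαs : Tendsto (fun N => ∑ n ∈ Finset.range N, α n) atTop atTop)
    (hs : Summable fun n => α n * ‖grad ν (X n)‖ ^ 2) :
    Tendsto (fun n => grad ν (X n)) atTop (𝓝 0) ∧
      Tendsto (fun n => Metric.infEDist (X n) (stationaryPoints k ν)) atTop (𝓝 0) := by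
  have hgrad : Tendsto (fun n => grad ν (X n)) atTop (𝓝 0) := by
    rw [tendsto_zero_iff_norm_tendsto_zero]
    by_contra hnot
    obtain ⟨ε, hε, hfreq⟩ : ∃ ε > 0, ∃ᶠ n in atTop, ε ≤ ‖grad ν (X n)‖ := by
      by_contra! hcon
      refine hnot (Metric.tendsto_nhds.2 fun ε hε => ?_)
      filter_upwards [hcon ε hε] with n hn
      simpa using hn
    -- With `η = 1 / (j + 1)`, the two ends of the excursions share a limit point `y`, at which the
    -- gradient is zero and continuous, yet its norm stays at least `ε` along `q`.
    choose p q hp hq hpq using fun j : ℕ => exists_short_excursion hc hX hα hα0 hαs hs hfreq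
      (Nat.one_div_pos_of_nat (α := ℝ) (n := j))
    obtain ⟨y, -, φ, hφ, hy⟩ := tendsto_subseq_of_bounded hbdd fun j => ⟨p j, rfl⟩
    have hsmall := (tendsto_one_div_add_atTop_nhds_zero_nat (𝕜 := ℝ)).comp hφ.tendsto_atTop
    have hgp : Tendsto (fun j => grad ν (X (p (φ j)))) atTop (𝓝 0) :=
      squeeze_zero_norm (fun j => hp (φ j)) hsmall
    obtain ⟨hy0, hcont⟩ := continuousAt_grad_of_tendsto hac hk (fun j => hinj (p (φ j)))
      (fun j => hC (p (φ j))) hy hgp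
    have hdiff : Tendsto (fun j => X (q (φ j)) - X (p (φ j))) atTop (𝓝 0) :=
      squeeze_zero_norm (fun j => hpq (φ j)) hsmall
    have hyq : Tendsto (fun j => X (q (φ j))) atTop (𝓝 y) := by
      simpa using hdiff.add hy
    have hgq := (hcont.tendsto.comp hyq).norm
    rw [hy0, norm_zero] at hgq
    exact absurd (ge_of_tendsto' hgq fun j => hq (φ j)) (not_le.2 hε)
  refine ⟨hgrad, tendsto_of_subseq_tendsto fun ns hns => ?_⟩
  obtain ⟨y, -, φ, hφ, hy⟩ := tendsto_subseq_of_bounded hbdd fun j => ⟨ns j, rfl⟩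
  have hns' : Tendsto (fun n => ns (φ n)) atTop atTop := hns.comp hφ.tendsto_atTop
  obtain ⟨hy0, -⟩ := continuousAt_grad_of_tendsto hac hk (fun j => hinj (ns (φ j)))
    (fun j => hC (ns (φ j))) hy (hgrad.comp hns')
  refine ⟨φ, tendsto_of_tendsto_of_tendsto_of_le_of_le tendsto_const_nhds
    (tendsto_iff_edist_tendsto_0.1 hy) (fun _ => zero_le) fun n => ?_⟩
  exact Metric.infEDist_le_edist_of_mem hy0

end Path

/-! ### The stochastic recursion -/

section Recursion

variable {Ω : Type*} [mΩ : MeasurableSpace Ω] {E : Type*} [NormedAddCommGroup E]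
  [InnerProductSpace ℝ E] [MeasurableSpace E] {k : ℕ}

/-- The stochastic gradient recursion driven by independent observations `Z n` with law `ν`, with
predictable steps `a n r` in `(0, 1/2]`. -/
structure IsRecursion (P : Measure Ω) (ν : Measure E) (Z : ℕ → Ω → E)
    (X : ℕ → Ω → Centers E k) (a : ℕ → Fin k → Ω → ℝ) : Prop where
  measurable_obs : ∀ n, Measurable (Z n)
  map_obs : ∀ n, P.map (Z n) = ν
  iIndepFun_obs : iIndepFun Z P
  measurable_init : Measurable (X 0)
  indepFun_init : IndepFun (X 0) (fun ω n => Z n ω) P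
  measurable_step : ∀ n r, Measurable[history (X 0) Z n] (a n r)
  succ_apply : ∀ n ω r, X (n + 1) ω r = X n ω r - a n r ω • direction r (Z n ω) (X n ω)
  step_pos : ∀ᵐ ω ∂P, ∀ n r, 0 < a n r ω
  step_le : ∀ᵐ ω ∂P, ∀ n r, a n r ω ≤ 1 / 2

variable {P : Measure Ω} {ν : Measure E} {Z : ℕ → Ω → E} {X : ℕ → Ω → Centers E k}
  {a : ℕ → Fin k → Ω → ℝ}

/-- The filtration of the `σ`-fields `history X₀ Z n`. -/
def historyFiltration {X₀ : Ω → Centers E k} (hX₀ : Measurable X₀) (hZ : ∀ n, Measurable (Z n)) :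
    Filtration ℕ mΩ where
  seq := history X₀ Z
  mono' _ n h := sup_le_sup_left (iSup_le fun i =>
    le_iSup (fun j : Fin n => MeasurableSpace.comap (Z j) inferInstance) (Fin.castLE h i)) _
  le' _ := sup_le hX₀.comap_le (iSup_le fun i => (hZ i).comap_le)

/-- The initial centres are independent of the whole sequence of observations, and the past
observations of the `n`-th one; `indep_sup_of_indep_sup` combines the two. -/
lemma indep_history [IsProbabilityMeasure P] (h : IsRecursion P ν Z X a) (n : ℕ) :
    Indep (history (X 0) Z n) (MeasurableSpace.comap (Z n) inferInstance) P := by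
  have hle : ∀ i, MeasurableSpace.comap (Z i) inferInstance ≤
      MeasurableSpace.comap (fun ω n => Z n ω) inferInstance := by
    rintro i _ ⟨s, hs, rfl⟩
    exact ⟨(fun z : ℕ → E => z i) ⁻¹' s, measurable_pi_apply i hs, rfl⟩
  refine indep_sup_of_indep_sup h.measurable_init.comap_le
    (iSup_le fun i => (h.measurable_obs i).comap_le) (h.measurable_obs n).comap_le ?_ ?_
  · exact indep_of_indep_of_le_right h.indepFun_init
      (sup_le (iSup_le fun i => hle i) (hle n))
  · have hd := indep_iSup_of_disjoint (fun i => (h.measurable_obs i).comap_le)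
      h.iIndepFun_obs.iIndep (S := Set.Iio n) (T := {n}) (by simp)
    refine indep_of_indep_of_le_left (indep_of_indep_of_le_right hd ?_) ?_
    · simp
    · exact iSup_le fun i => le_iSup₂_of_le (i : ℕ) i.2 le_rfl

lemma indepFun_of_measurable_history [IsProbabilityMeasure P] (h : IsRecursion P ν Z X a)
    {α : Type*} [MeasurableSpace α] {n : ℕ} {Y : Ω → α} (hY : Measurable[history (X 0) Z n] Y) :
    IndepFun Y (Z n) P :=
  indep_of_indep_of_le_left (indep_history h n) hY.comap_le

lemma history_le (h : IsRecursion P ν Z X a) (n : ℕ) : history (X 0) Z n ≤ mΩ :=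
  (historyFiltration h.measurable_init h.measurable_obs).le n

/-- A crude bound growing with `n`, enough to make each objective value integrable when `Z` is
unbounded. -/
lemma ae_norm_apply_le (h : IsRecursion P ν Z X a) {K : ℝ}
    (hX : ∀ᵐ ω ∂P, ∀ r, ‖X 0 ω r‖ ≤ K) : ∀ᵐ ω ∂P, ∀ n r, ‖X n ω r‖ ≤ K + n / 2 := by
  filter_upwards [hX, h.step_pos, h.step_le] with ω hω hpos hle n r
  induction n with
  | zero => simpa using hω r
  | succ n ih =>
    rw [h.succ_apply]
    have h1 : ‖a n r ω • direction r (Z n ω) (X n ω)‖ ≤ 1 / 2 := by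
      rw [norm_smul, Real.norm_of_nonneg (hpos n r).le]
      exact (mul_le_of_le_one_right (hpos n r).le (norm_direction_le_one _ _ _)).trans (hle n r)
    have h2 := norm_sub_le (X n ω r) (a n r ω • direction r (Z n ω) (X n ω))
    push_cast
    linarith

lemma integrable_step_pow [IsProbabilityMeasure P] (h : IsRecursion P ν Z X a) (n : ℕ)
    (r : Fin k) (m : ℕ) : Integrable (fun ω => a n r ω ^ m) P := by
  refine .of_bound (((h.measurable_step n r).mono (history_le h n) le_rfl).pow_const m
    ).aestronglyMeasurable 1 ?_
  filter_upwards [h.step_pos, h.step_le] with ω h0 h1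
  rw [norm_pow, Real.norm_of_nonneg (h0 n r).le]
  exact pow_le_one₀ (h0 n r).le ((h1 n r).trans (by norm_num))

lemma ae_norm_apply_le_of_bounded (h : IsRecursion P ν Z X a) {K : ℝ}
    (hX : ∀ᵐ ω ∂P, ∀ r, ‖X 0 ω r‖ ≤ K) (hν : ∀ᵐ z ∂ν, ‖z‖ ≤ K) :
    ∀ᵐ ω ∂P, ∀ n r, ‖X n ω r‖ ≤ K + 1 := by
  have hZ : ∀ᵐ ω ∂P, ∀ n, ‖Z n ω‖ ≤ K := ae_all_iff.2 fun n =>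
    ae_of_ae_map (h.measurable_obs n).aemeasurable (by rwa [h.map_obs])
  filter_upwards [hX, hZ, h.step_pos, h.step_le] with ω hω hZ hpos hle n r
  have : ‖X n ω r‖ ≤ K + 1 / 2 := by
    induction n with
    | zero => linarith [hω r]
    | succ n ih =>
      rw [h.succ_apply]
      exact norm_sub_smul_direction_le (hZ n) ih (hpos n r) (hle n r)
  linarith

variable [FiniteDimensional ℝ E] [BorelSpace E]

lemma measurable_history_apply (h : IsRecursion P ν Z X a) (n : ℕ) :
    Measurable[history (X 0) Z n] (X n) := by
  induction n with
  | zero => exact (comap_measurable (X 0)).mono le_sup_left le_rfl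
  | succ n ih =>
    have hmono : history (X 0) Z n ≤ history (X 0) Z (n + 1) :=
      (historyFiltration h.measurable_init h.measurable_obs).mono n.le_succ
    have hX : Measurable[history (X 0) Z (n + 1)] (X n) := ih.mono hmono le_rfl
    have hZ : Measurable[history (X 0) Z (n + 1)] (Z n) :=
      (comap_measurable (Z n)).mono (le_sup_of_le_right
        (le_iSup (fun j : Fin (n + 1) => MeasurableSpace.comap (Z j) inferInstance)
          (Fin.last n))) le_rfl
    have heq : X (n + 1) = fun ω => WithLp.toLp 2 fun r =>
        X n ω r - a n r ω • direction r (Z n ω) (X n ω) := by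
      funext ω
      exact PiLp.ext fun r => h.succ_apply n ω r
    rw [heq]
    refine (WithLp.measurable_toLp 2 _).comp
      (@measurable_pi_lambda _ _ _ (history (X 0) Z (n + 1)) _ _ fun r => ?_)
    have happ : Measurable fun x : Centers E k => x r := by fun_prop
    refine Measurable.sub (happ.comp hX) (Measurable.smul
      ((h.measurable_step n r).mono hmono le_rfl) ?_)
    exact measurable_direction_comp hZ hX r

/-- Plays the role of conditional expectation given the past: the event and the weight are bundled
with the centres into one variable independent of `Z n`. -/
lemma setIntegral_mul_comp_eq [IsProbabilityMeasure P] (h : IsRecursion P ν Z X a) {n : ℕ}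
    {s : Set Ω} (hs : MeasurableSet[history (X 0) Z n] s) {b : Ω → ℝ}
    (hb : Measurable[history (X 0) Z n] b) (hbi : Integrable b P) {φ : E → Centers E k → ℝ}
    (hφ : Measurable (Function.uncurry φ)) {c : ℝ} (hc : ∀ z x, |φ z x| ≤ c) :
    ∫ ω in s, b ω * φ (Z n ω) (X n ω) ∂P = ∫ ω in s, b ω * ∫ z, φ z (X n ω) ∂ν ∂P := by
  have hs' := history_le h n _ hs
  have hY : Measurable[history (X 0) Z n] fun ω => (s.indicator b ω, X n ω) :=
    Measurable.prodMk (hb.indicator hs) (measurable_history_apply h n)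
  have hY' : Measurable fun ω => (s.indicator b ω, X n ω) := hY.mono (history_le h n) le_rfl
  have hperm : Measurable fun q : E × ℝ × Centers E k => (q.1, q.2.2) :=
    measurable_fst.prodMk (measurable_snd.comp measurable_snd)
  have hφ' : Measurable (Function.uncurry fun (z : E) (y : ℝ × Centers E k) => φ z y.2) :=
    hφ.comp hperm
  have key := integral_comp_eq_of_indepFun hY' (h.measurable_obs n)
    (indepFun_of_measurable_history h hY) hφ' (fun z y => hc z y.2) (b := Prod.fst)
    measurable_fst (hbi.indicator hs')
  rw [h.map_obs] at key
  rw [← integral_indicator hs', ← integral_indicator hs']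
  simpa only [Set.indicator_mul_left] using key

/-- Without a tie, at least one of the two centres does not move. The other moves along its line
through `z`, so a collision would put `z` on the line through both centres. -/
lemma ae_sub_smul_direction_ne (hac : ν ≪ volume) (hd : 2 ≤ Module.finrank ℝ E)
    {x : Centers E k} {r s : Fin k} (hrs : x r ≠ x s) (b c : ℝ) :
    ∀ᵐ z ∂ν, x r - b • direction r z x ≠ x s - c • direction s z x := by
  filter_upwards [ae_norm_sub_ne hac hrs, ae_notMem_line hac hd (x r) (x s),
    ae_notMem_line hac hd (x s) (x r)] with z htie hl1 hl2 heq
  have key : ∀ {p q : E} {t : ℝ}, p ≠ q → p - t • (p - z) = q → ∃ u : ℝ, z = p + u • (q - p) := by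
    intro p q t hpq hq
    have ht : t ≠ 0 := by
      rintro rfl
      simp at hq
      exact hpq hq
    refine ⟨t⁻¹, ?_⟩
    rw [← hq, sub_sub_cancel_left, smul_neg, smul_smul, inv_mul_cancel₀ ht, one_smul]
    abel
  rcases lt_or_gt_of_ne htie with hlt | hlt
  · simp only [direction, nearest_eq_zero hlt, zero_div, zero_smul, smul_zero, sub_zero,
      smul_smul] at heq
    obtain ⟨u, hu⟩ := key hrs heq
    exact hl1 u hu
  · simp only [direction, nearest_eq_zero hlt, zero_div, zero_smul, smul_zero, sub_zero,
      smul_smul] at heq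
    obtain ⟨u, hu⟩ := key hrs.symm heq.symm
    exact hl2 u hu

/-- Two coinciding centres form a proper subspace of the configuration space, hence a null set. -/
lemma ae_injective_of_absolutelyContinuous [Nontrivial E] {X₀ : Ω → Centers E k}
    (hX₀ : Measurable X₀) (hac : P.map X₀ ≪ volume) :
    ∀ᵐ ω ∂P, Function.Injective fun r => X₀ ω r := by
  have hne : ∀ r s : Fin k, r ≠ s → ∀ᵐ x : Centers E k, x r ≠ x s := fun r s hrs => by
    set L : Centers E k →ₗ[ℝ] E :=
      (PiLp.projₗ 2 (fun _ : Fin k => E) r : _ →ₗ[ℝ] E) - PiLp.projₗ 2 (fun _ : Fin k => E) s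
    have hL : ∀ x, L x = x r - x s := fun x => rfl
    have htop : LinearMap.ker L ≠ ⊤ := fun h => by
      obtain ⟨v, hv⟩ := exists_ne (0 : E)
      have h1 : WithLp.toLp 2 (Pi.single r v : Fin k → E) ∈ LinearMap.ker L :=
        h ▸ Submodule.mem_top
      rw [LinearMap.mem_ker, hL] at h1
      simp [hrs.symm] at h1
      exact hv h1
    have h0 := Measure.addHaar_submodule (volume : Measure (Centers E k)) _ htop
    rw [ae_iff]
    convert h0 using 2
    ext x
    simp [hL, sub_eq_zero]
  have hall : ∀ᵐ ω ∂P, ∀ r s, r ≠ s → X₀ ω r ≠ X₀ ω s := by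
    refine ae_all_iff.2 fun r => ae_all_iff.2 fun s => ?_
    by_cases hrs : r = s
    · simp [hrs]
    · filter_upwards [ae_of_ae_map hX₀.aemeasurable (hac.ae_le (hne r s hrs))] with ω hω _ using hω
  filter_upwards [hall] with ω hω r s hrs
  by_contra hne
  exact hω r s hne hrs

lemma ae_injective [IsProbabilityMeasure P] [Nontrivial E] (h : IsRecursion P ν Z X a)
    (hX : P.map (X 0) ≪ volume) (hac : ν ≪ volume) (hd : 2 ≤ Module.finrank ℝ E) :
    ∀ᵐ ω ∂P, ∀ n, Function.Injective fun r => X n ω r := by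
  refine ae_all_iff.2 fun n => ?_
  induction n with
  | zero => exact ae_injective_of_absolutelyContinuous h.measurable_init hX
  | succ n ih =>
    have hall : ∀ᵐ ω ∂P, ∀ r s, r ≠ s → X (n + 1) ω r ≠ X (n + 1) ω s := by
      refine ae_all_iff.2 fun r => ae_all_iff.2 fun s => ?_
      by_cases hrs : r = s
      · simp [hrs]
      have hY : Measurable[history (X 0) Z n] fun ω => (X n ω, a n r ω, a n s ω) :=
        Measurable.prodMk (measurable_history_apply h n)
          (Measurable.prodMk (h.measurable_step n r) (h.measurable_step n s))
      have hdir : ∀ t, Measurable fun q : (Centers E k × ℝ × ℝ) × E => direction t q.2 q.1.1 :=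
        fun t => measurable_direction_comp measurable_snd (measurable_fst.comp measurable_fst) t
      have happ : ∀ t, Measurable fun q : (Centers E k × ℝ × ℝ) × E => q.1.1 t := fun t => by
        fun_prop
      have hY' : Measurable fun ω => (X n ω, a n r ω, a n s ω) := hY.mono (history_le h n) le_rfl
      have key := ae_of_indepFun hY' (h.measurable_obs n)
        (indepFun_of_measurable_history h hY)
        (p := fun q => q.1.1 r - q.1.2.1 • direction r q.2 q.1.1 ≠
          q.1.1 s - q.1.2.2 • direction s q.2 q.1.1) ?_ ?_
      · filter_upwards [key] with ω hω _
        rw [h.succ_apply, h.succ_apply]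
        exact hω
      · refine (measurableSet_eq_fun ?_ ?_).compl
        · exact (happ r).sub ((measurable_fst.comp (measurable_snd.comp measurable_fst)).smul
            (hdir r))
        · exact (happ s).sub ((measurable_snd.comp (measurable_snd.comp measurable_fst)).smul
            (hdir s))
      · filter_upwards [ih] with ω hω
        rw [h.map_obs]
        exact ae_sub_smul_direction_ne hac hd (hω.ne hrs) _ _
    filter_upwards [hall] with ω hω r s hrs
    by_contra hne
    exact hω r s hne hrs

lemma measurable_uncurry_nearest (r : Fin k) :
    Measurable (Function.uncurry fun (z : E) (x : Centers E k) => nearest r z x) :=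
  measurable_nearest r

/-- Both forms of (H3) lead to the error series of the descent inequality: the first dominates it,
and in the second the indicator may be replaced by its conditional mean, so that the series has
finite expectation. -/
lemma ae_summable_sq_mul_nearestProb [IsProbabilityMeasure P] [IsProbabilityMeasure ν]
    (h : IsRecursion P ν Z X a)
    (H3 : (∀ᵐ ω ∂P, ∀ r, Summable fun n => (a n r ω) ^ 2) ∨
      (∑ r, ∑' n, ∫⁻ ω,
        ENNReal.ofReal ((a n r ω) ^ 2 * nearest r (Z n ω) (X n ω)) ∂P) < ∞) :
    ∀ᵐ ω ∂P, ∀ r, Summable fun n => (a n r ω) ^ 2 * nearestProb ν r (X n ω) := by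
  rcases H3 with H3 | H3
  · filter_upwards [H3] with ω hω r
    exact Summable.of_nonneg_of_le (fun n => mul_nonneg (sq_nonneg _) (nearestProb_nonneg _ _))
      (fun n => mul_le_of_le_one_right (sq_nonneg _) (nearestProb_le_one _ _)) (hω r)
  · refine ae_all_iff.2 fun r => ?_
    have hr := ENNReal.sum_lt_top.1 H3 r (Finset.mem_univ r)
    have hXm : ∀ n, Measurable (X n) := fun n =>
      (measurable_history_apply h n).mono (history_le h n) le_rfl
    have ham : ∀ n, Measurable (a n r) := fun n =>
      (h.measurable_step n r).mono (history_le h n) le_rfl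
    have hpm : ∀ n, Measurable fun ω => (a n r ω) ^ 2 * nearestProb ν r (X n ω) := fun n =>
      ((ham n).pow_const 2).mul ((measurable_nearestProb r).comp (hXm n))
    have heq : ∀ n, ∫⁻ ω, ENNReal.ofReal ((a n r ω) ^ 2 * nearest r (Z n ω) (X n ω)) ∂P =
        ∫⁻ ω, ENNReal.ofReal ((a n r ω) ^ 2 * nearestProb ν r (X n ω)) ∂P := fun n => by
      have h1 := setIntegral_mul_comp_eq h (n := n) (MeasurableSet.univ (m := history (X 0) Z n))
        ((h.measurable_step n r).pow_const 2) (integrable_step_pow h n r 2)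
        (measurable_uncurry_nearest r) (fun z x => abs_nearest_le_one r z x)
      rw [setIntegral_univ, setIntegral_univ] at h1
      rw [← ofReal_integral_eq_lintegral_ofReal, ← ofReal_integral_eq_lintegral_ofReal, h1]
      · rfl
      · exact (integrable_step_pow h n r 2).mul_bdd (c := 1)
          ((measurable_nearestProb r).comp (hXm n)).aestronglyMeasurable
          (Eventually.of_forall fun ω => by
            rw [Real.norm_of_nonneg (nearestProb_nonneg _ _)]; exact nearestProb_le_one _ _)
      · exact Eventually.of_forall fun ω => mul_nonneg (sq_nonneg _) (nearestProb_nonneg _ _)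
      · exact (integrable_step_pow h n r 2).mul_bdd (c := 1)
          ((measurable_nearest r).comp
            ((h.measurable_obs n).prodMk (hXm n))).aestronglyMeasurable
          (Eventually.of_forall fun ω => abs_nearest_le_one _ _ _)
      · exact Eventually.of_forall fun ω => mul_nonneg (sq_nonneg _) (nearest_nonneg _ _ _)
    simp only [heq] at hr
    rw [← lintegral_tsum fun n => (hpm n).ennreal_ofReal.aemeasurable] at hr
    filter_upwards [ae_lt_top (Measurable.tsum fun n => (hpm n).ennreal_ofReal) hr.ne]
      with ω hω
    refine (ENNReal.summable_toReal hω.ne).congr fun n => ?_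
    exact ENNReal.toReal_ofReal (mul_nonneg (sq_nonneg _) (nearestProb_nonneg _ _))

/-- The conditional descent inequality, integrated over an event of the past. -/
lemma setIntegral_objective_succ_le [IsProbabilityMeasure P] [IsProbabilityMeasure ν]
    [Nontrivial E] (h : IsRecursion P ν Z X a) (hk : 1 ≤ k) (hac : ν ≪ volume)
    (hν : Integrable (fun z : E => z) ν) {C : ℝ} (hC0 : 0 ≤ C)
    (hinj : ∀ᵐ ω ∂P, ∀ n, Function.Injective fun r => X n ω r)
    (hC : ∀ᵐ ω ∂P, ∀ n r, ∫⁻ z, ‖z - X n ω r‖ₑ⁻¹ ∂ν < ENNReal.ofReal C)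
    (hV : ∀ n, Integrable (fun ω => objective ν (X n ω)) P)
    (hA : ∀ n r, Integrable (fun ω => a n r ω * ‖grad ν (X n ω) r‖ ^ 2) P)
    (hB : ∀ n r, Integrable (fun ω => a n r ω ^ 2 * nearestProb ν r (X n ω)) P)
    {n : ℕ} {s : Set Ω} (hs : MeasurableSet[history (X 0) Z n] s) :
    ∫ ω in s, objective ν (X (n + 1) ω) ∂P ≤ ∫ ω in s, (objective ν (X n ω) -
      ∑ r, a n r ω * ‖grad ν (X n ω) r‖ ^ 2 +
      C / 2 * ∑ r, a n r ω ^ 2 * nearestProb ν r (X n ω)) ∂P := by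
  have hXm : Measurable (X n) := (measurable_history_apply h n).mono (history_le h n) le_rfl
  set φ : Fin k → E → Centers E k → ℝ := fun r z x => inner ℝ (grad ν x r) (direction r z x)
  have hφm : ∀ r, Measurable (Function.uncurry (φ r)) := fun r =>
    ((measurable_grad_apply r).comp measurable_snd).inner (measurable_direction r)
  have hφ1 : ∀ r z x, |φ r z x| ≤ 1 := fun r z x =>
    (abs_real_inner_le_norm _ _).trans (mul_le_one₀
      ((norm_grad_apply_le r x).trans (nearestProb_le_one r x)) (norm_nonneg _)
      (norm_direction_le_one r z x))
  -- Averaging the direction over the fresh observation turns the cross term into the squared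
  -- gradient.
  have hφν : ∀ r x, ∫ z, φ r z x ∂ν = ‖grad ν x r‖ ^ 2 := fun r x => by
    rw [← real_inner_self_eq_norm_sq, inner_grad_apply]
    simp only [φ, real_inner_comm]
  have hpair : Measurable fun ω => (Z n ω, X n ω) := (h.measurable_obs n).prodMk hXm
  have hA' : ∀ r, Integrable (fun ω => a n r ω * φ r (Z n ω) (X n ω)) P := fun r =>
    (by simpa using integrable_step_pow h n r 1 : Integrable (a n r) P).mul_bdd (c := 1)
      ((hφm r).comp hpair).aestronglyMeasurable (Eventually.of_forall fun ω => hφ1 _ _ _)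
  have hB' : ∀ r, Integrable (fun ω => a n r ω ^ 2 * nearest r (Z n ω) (X n ω)) P := fun r =>
    (integrable_step_pow h n r 2).mul_bdd (c := 1)
      ((measurable_nearest r).comp hpair).aestronglyMeasurable
      (Eventually.of_forall fun ω => abs_nearest_le_one _ _ _)
  have hpt : ∀ᵐ ω ∂P, objective ν (X (n + 1) ω) ≤ objective ν (X n ω) -
      ∑ r, a n r ω * φ r (Z n ω) (X n ω) +
      C / 2 * ∑ r, a n r ω ^ 2 * nearest r (Z n ω) (X n ω) := by
    filter_upwards [hinj, hC] with ω hinj hC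
    have h1 := objective_le hk hac hν (hinj n) (hC n) (X (n + 1) ω)
    have hstep : ∀ r, X (n + 1) ω r - X n ω r = -(a n r ω • direction r (Z n ω) (X n ω)) :=
      fun r => by rw [h.succ_apply]; abel
    simp only [hstep, inner_neg_right, inner_smul_right, Finset.sum_neg_distrib, norm_neg] at h1
    have h2 : ∑ r, ‖a n r ω • direction r (Z n ω) (X n ω)‖ ^ 2 ≤
        ∑ r, a n r ω ^ 2 * nearest r (Z n ω) (X n ω) := by
      refine Finset.sum_le_sum fun r _ => ?_
      rw [norm_smul, mul_pow, Real.norm_eq_abs, sq_abs]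
      refine mul_le_mul_of_nonneg_left ?_ (sq_nonneg _)
      have h3 := norm_direction_le r (Z n ω) (X n ω)
      -- The direction has norm at most one, so its square is bounded by its norm and hence by the
      -- cell indicator.
      exact (pow_le_of_le_one (norm_nonneg _) (norm_direction_le_one _ _ _) two_ne_zero).trans h3
    have h3 := mul_le_mul_of_nonneg_left h2 (by linarith : 0 ≤ C / 2)
    simp only [φ]
    linarith
  have hAs : Integrable (fun ω => ∑ r, a n r ω * ‖grad ν (X n ω) r‖ ^ 2) P :=
    integrable_finsetSum _ fun r _ => hA n r
  have hBs : Integrable (fun ω => C / 2 * ∑ r, a n r ω ^ 2 * nearestProb ν r (X n ω)) P :=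
    (integrable_finsetSum _ fun r _ => hB n r).const_mul _
  have hAs' : Integrable (fun ω => ∑ r, a n r ω * φ r (Z n ω) (X n ω)) P :=
    integrable_finsetSum _ fun r _ => hA' r
  have hBs' : Integrable (fun ω => C / 2 * ∑ r, a n r ω ^ 2 * nearest r (Z n ω) (X n ω)) P :=
    (integrable_finsetSum _ fun r _ => hB' r).const_mul _
  refine (setIntegral_mono_ae (hV (n + 1)).integrableOn
    (((hV n).sub hAs').add hBs').integrableOn hpt).trans (le_of_eq ?_)
  have hVA' : Integrable (fun ω => objective ν (X n ω) -
    ∑ r, a n r ω * φ r (Z n ω) (X n ω)) P := (hV n).sub hAs'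
  have hVA : Integrable (fun ω => objective ν (X n ω) -
    ∑ r, a n r ω * ‖grad ν (X n ω) r‖ ^ 2) P := (hV n).sub hAs
  simp only [Pi.add_apply, Pi.sub_apply]
  rw [integral_add hVA'.integrableOn hBs'.integrableOn, integral_add hVA.integrableOn
    hBs.integrableOn, integral_sub (hV n).integrableOn hAs'.integrableOn,
    integral_sub (hV n).integrableOn hAs.integrableOn, integral_const_mul, integral_const_mul,
    integral_finsetSum _ fun r _ => (hA' r).integrableOn,
    integral_finsetSum _ fun r _ => (hB' r).integrableOn,
    integral_finsetSum _ fun r _ => (hA n r).integrableOn,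
    integral_finsetSum _ fun r _ => (hB n r).integrableOn]
  have e1 : ∀ r, ∫ ω in s, a n r ω * φ r (Z n ω) (X n ω) ∂P =
      ∫ ω in s, a n r ω * ‖grad ν (X n ω) r‖ ^ 2 ∂P := fun r => by
    rw [setIntegral_mul_comp_eq h hs (h.measurable_step n r)
      (by simpa using integrable_step_pow h n r 1) (hφm r) (hφ1 r)]
    simp only [hφν]
  have e2 : ∀ r, ∫ ω in s, a n r ω ^ 2 * nearest r (Z n ω) (X n ω) ∂P =
      ∫ ω in s, a n r ω ^ 2 * nearestProb ν r (X n ω) ∂P := fun r =>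
    setIntegral_mul_comp_eq h hs ((h.measurable_step n r).pow_const 2)
      (integrable_step_pow h n r 2) (measurable_uncurry_nearest r)
      (fun z x => abs_nearest_le_one r z x)
  simp only [e1, e2]

theorem ae_tendsto_objective_and_summable [IsProbabilityMeasure P] [IsProbabilityMeasure ν]
    [Nontrivial E] (h : IsRecursion P ν Z X a) (hk : 1 ≤ k) (hac : ν ≪ volume)
    (hν : Integrable (fun z : E => z) ν) {K C : ℝ} (hC0 : 0 ≤ C)
    (hX : ∀ᵐ ω ∂P, ∀ r, ‖X 0 ω r‖ ≤ K)
    (hinj : ∀ᵐ ω ∂P, ∀ n, Function.Injective fun r => X n ω r)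
    (hC : ∀ᵐ ω ∂P, ∀ n r, ∫⁻ z, ‖z - X n ω r‖ₑ⁻¹ ∂ν < ENNReal.ofReal C)
    (hsum : ∀ᵐ ω ∂P, ∀ r, Summable fun n => (a n r ω) ^ 2 * nearestProb ν r (X n ω)) :
    ∀ᵐ ω ∂P, (∃ l : ℝ, Tendsto (fun n => objective ν (X n ω)) atTop (𝓝 l)) ∧
      ∀ r, Summable fun n => a n r ω * ‖grad ν (X n ω) r‖ ^ 2 := by
  have hXh := measurable_history_apply h
  have hXm : ∀ n, Measurable (X n) := fun n => (hXh n).mono (history_le h n) le_rfl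
  have hV : ∀ n, Integrable (fun ω => objective ν (X n ω)) P := fun n => by
    refine .of_bound (measurable_objective.comp (hXm n)).aestronglyMeasurable
      (∫ z, ‖z‖ ∂ν + (K + n / 2)) ?_
    filter_upwards [ae_norm_apply_le h hX] with ω hω
    rw [Real.norm_of_nonneg (objective_nonneg _)]
    linarith [objective_le_add hν ⟨0, hk⟩ (X n ω), hω n ⟨0, hk⟩]
  have hA : ∀ n r, Integrable (fun ω => a n r ω * ‖grad ν (X n ω) r‖ ^ 2) P := fun n r => by
    refine (by simpa using integrable_step_pow h n r 1 : Integrable (a n r) P).mul_bdd (c := 1)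
      (((measurable_grad_apply r).comp (hXm n)).norm.pow_const 2).aestronglyMeasurable
      (Eventually.of_forall fun ω => ?_)
    rw [norm_pow, norm_norm]
    exact pow_le_one₀ (norm_nonneg _) ((norm_grad_apply_le _ _).trans (nearestProb_le_one _ _))
  have hB : ∀ n r, Integrable (fun ω => a n r ω ^ 2 * nearestProb ν r (X n ω)) P := fun n r => by
    refine (integrable_step_pow h n r 2).mul_bdd (c := 1)
      ((measurable_nearestProb r).comp (hXm n)).aestronglyMeasurable
      (Eventually.of_forall fun ω => ?_)
    rw [Real.norm_of_nonneg (nearestProb_nonneg _ _)]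
    exact nearestProb_le_one _ _
  have hAm : ∀ n, Measurable[history (X 0) Z n] fun ω =>
      ∑ r, a n r ω * ‖grad ν (X n ω) r‖ ^ 2 := fun n => by
    refine Finset.measurable_sum _ fun r _ => Measurable.mul (h.measurable_step n r) ?_
    exact ((measurable_grad_apply r).norm.pow_const 2).comp (hXh n)
  have hBm : ∀ n, Measurable[history (X 0) Z n] fun ω =>
      C / 2 * ∑ r, a n r ω ^ 2 * nearestProb ν r (X n ω) := fun n => by
    refine Measurable.const_mul (Finset.measurable_sum _ fun r _ =>
      Measurable.mul ((h.measurable_step n r).pow_const 2) ?_) _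
    exact (measurable_nearestProb r).comp (hXh n)
  have key := ae_tendsto_and_summable_of_almost_supermartingale (P := P)
    (ℱ := historyFiltration h.measurable_init h.measurable_obs)
    (V := fun n ω => objective ν (X n ω))
    (A := fun n ω => ∑ r, a n r ω * ‖grad ν (X n ω) r‖ ^ 2)
    (B := fun n ω => C / 2 * ∑ r, a n r ω ^ 2 * nearestProb ν r (X n ω))
    (fun n => measurable_objective.comp (hXh n))
    hAm hBm hV (fun n => integrable_finsetSum _ fun r _ => hA n r)
    (fun n => (integrable_finsetSum _ fun r _ => hB n r).const_mul _)
    (Eventually.of_forall fun ω n => objective_nonneg _)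
    (by
      filter_upwards [h.step_pos] with ω hω n
      exact Finset.sum_nonneg fun r _ => mul_nonneg (hω n r).le (sq_nonneg _))
    (Eventually.of_forall fun ω n => mul_nonneg (by linarith) (Finset.sum_nonneg fun r _ =>
      mul_nonneg (sq_nonneg _) (nearestProb_nonneg _ _)))
    (fun n s hs => setIntegral_objective_succ_le h hk hac hν hC0 hinj hC hV hA hB hs)
    (by
      filter_upwards [hsum] with ω hω
      exact (summable_sum fun r _ => hω r).mul_left _)
  filter_upwards [key, h.step_pos] with ω hω hpos
  refine ⟨hω.1, fun r => Summable.of_nonneg_of_le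
    (fun n => mul_nonneg (hpos n r).le (sq_nonneg _)) (fun n => ?_) hω.2⟩
  exact Finset.single_le_sum (f := fun r => a n r ω * ‖grad ν (X n ω) r‖ ^ 2)
    (fun s _ => mul_nonneg (hpos n s).le (sq_nonneg _)) (Finset.mem_univ r)

lemma norm_le_mul_of_forall_norm_le {F : Type*} [NormedAddCommGroup F] {v : Centers F k} {c : ℝ}
    (hc : 0 ≤ c) (hv : ∀ r, ‖v r‖ ≤ c) : ‖v‖ ≤ k * c := by
  refine le_of_sq_le_sq ?_ (by positivity)
  rw [PiLp.norm_sq_eq_of_L2]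
  refine (Finset.sum_sq_le_sq_sum_of_nonneg fun r _ => norm_nonneg (v r)).trans ?_
  have h1 : ∑ r, ‖v r‖ ≤ k * c := by
    simpa using Finset.sum_le_card_nsmul Finset.univ (fun r => ‖v r‖) c fun r _ => hv r
  have h2 : 0 ≤ ∑ r, ‖v r‖ := Finset.sum_nonneg fun r _ => norm_nonneg _
  gcongr

/-- Pathwise application of `tendsto_grad_and_infEDist` with `α n = maxᵣ a n r`; the bounded ratio
makes each individual step comparable with `α n`. -/
theorem ae_tendsto_grad [IsProbabilityMeasure P] [IsProbabilityMeasure ν]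
    [Nontrivial E] (h : IsRecursion P ν Z X a) (hk : 1 ≤ k) (hac : ν ≪ volume)
    {K C : ℝ} (hK : 0 ≤ K) (hXK : ∀ᵐ ω ∂P, ∀ n r, ‖X n ω r‖ ≤ K)
    (hinj : ∀ᵐ ω ∂P, ∀ n, Function.Injective fun r => X n ω r)
    (hC : ∀ᵐ ω ∂P, ∀ n r, ∫⁻ z, ‖z - X n ω r‖ₑ⁻¹ ∂ν < ENNReal.ofReal C)
    (hsum : ∀ᵐ ω ∂P, ∀ r, Summable fun n => (a n r ω) ^ 2 * nearestProb ν r (X n ω))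
    (hgrad : ∀ᵐ ω ∂P, ∀ r, Summable fun n => a n r ω * ‖grad ν (X n ω) r‖ ^ 2)
    (hdiv : ∀ᵐ ω ∂P, Tendsto (fun N => ∑ n ∈ Finset.range N, ⨆ r, a n r ω) atTop atTop)
    (hratio : ∀ᵐ ω ∂P, BddAbove (Set.range fun n => (⨆ r, a n r ω) / (⨅ r, a n r ω))) :
    ∀ᵐ ω ∂P, Tendsto (fun n => grad ν (X n ω)) atTop (𝓝 0) ∧
      Tendsto (fun n => Metric.infEDist (X n ω) (stationaryPoints k ν)) atTop (𝓝 0) := by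
  have : Nonempty (Fin k) := ⟨⟨0, hk⟩⟩
  filter_upwards [h.step_pos, hXK, hinj, hC, hsum, hgrad, hdiv, hratio]
    with ω hpos hXK hinj hC hsum hgrad hdiv ⟨ρ, hρ⟩
  have hsup : ∀ n r, a n r ω ≤ ⨆ r, a n r ω := fun n r =>
    le_ciSup (Set.finite_range fun r => a n r ω).bddAbove r
  have hα : ∀ n, 0 < ⨆ r, a n r ω := fun n => (hpos n ⟨0, hk⟩).trans_le (hsup n _)
  have hle : ∀ n r, ⨆ r, a n r ω ≤ ρ * a n r ω := fun n r => by
    obtain ⟨j, hj⟩ := exists_eq_ciInf_of_finite (f := fun r => a n r ω)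
    have hinf : 0 < ⨅ r, a n r ω := hj ▸ hpos n j
    have h1 : (⨆ r, a n r ω) / (⨅ r, a n r ω) ≤ ρ := hρ ⟨n, rfl⟩
    have hρ0 : 0 ≤ ρ := (div_pos (hα n) hinf).le.trans h1
    rw [div_le_iff₀ hinf] at h1
    exact h1.trans (mul_le_mul_of_nonneg_left
      (ciInf_le (Set.finite_range fun r => a n r ω).bddBelow r) hρ0)
  -- The cell probabilities sum to at least one, so the weighted squares control the largest squared
  -- step up to `ρ²`. This yields `α n → 0` under either form of (H3).
  have hsq : Summable fun n => (⨆ r, a n r ω) ^ 2 := by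
    refine Summable.of_nonneg_of_le (fun n => sq_nonneg _) (fun n => ?_)
      ((summable_sum fun r (_ : r ∈ Finset.univ) => hsum r).mul_left (ρ ^ 2))
    calc (⨆ r, a n r ω) ^ 2 ≤ (⨆ r, a n r ω) ^ 2 * ∑ r, nearestProb ν r (X n ω) :=
          le_mul_of_one_le_right (sq_nonneg _) (one_le_sum_nearestProb hk _)
      _ ≤ ρ ^ 2 * ∑ r, a n r ω ^ 2 * nearestProb ν r (X n ω) := by
          rw [Finset.mul_sum, Finset.mul_sum]
          refine Finset.sum_le_sum fun r _ => ?_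
          rw [← mul_assoc, ← mul_pow]
          exact mul_le_mul_of_nonneg_right (pow_le_pow_left₀ (hα n).le (hle n r) 2)
            (nearestProb_nonneg _ _)
  have hα0 : Tendsto (fun n => ⨆ r, a n r ω) atTop (𝓝 0) := by
    have h1 := hsq.tendsto_atTop_zero.sqrt
    rw [Real.sqrt_zero] at h1
    exact h1.congr fun n => Real.sqrt_sq (hα n).le
  refine tendsto_grad_and_infEDist hac hk hinj hC ?_ (c := k) k.cast_nonneg (fun n => ?_)
    (fun n => (hα n).le) hα0 hdiv ?_
  · refine (isBounded_iff_forall_norm_le).2 ⟨k * K, ?_⟩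
    rintro _ ⟨n, rfl⟩
    exact norm_le_mul_of_forall_norm_le hK (hXK n)
  · refine norm_le_mul_of_forall_norm_le (hα n).le fun r => ?_
    rw [PiLp.sub_apply, h.succ_apply, sub_sub_cancel_left, norm_neg, norm_smul,
      Real.norm_of_nonneg (hpos n r).le]
    exact (mul_le_of_le_one_right (hpos n r).le (norm_direction_le_one _ _ _)).trans (hsup n r)
  · refine Summable.of_nonneg_of_le (fun n => mul_nonneg (hα n).le (sq_nonneg _)) (fun n => ?_)
      ((summable_sum fun r (_ : r ∈ Finset.univ) => hgrad r).mul_left ρ)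
    rw [PiLp.norm_sq_eq_of_L2, Finset.mul_sum, Finset.mul_sum]
    refine Finset.sum_le_sum fun r _ => ?_
    rw [← mul_assoc]
    exact mul_le_mul_of_nonneg_right (hle n r) (sq_nonneg _)

end Recursion

end KMedians

end

/-- Time is indexed from `0`: `X 0` is the system of initial centres, `Z 0` the first observation. -/
theorem theorem1
    {Ω : Type*} [MeasurableSpace Ω] (P : Measure Ω) [IsProbabilityMeasure P]
    {E : Type*} [NormedAddCommGroup E] [InnerProductSpace ℝ E] [FiniteDimensional ℝ E]
    [MeasurableSpace E] [BorelSpace E]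
    (k : ℕ) (hk : 1 ≤ k)
    -- the law `ν` of `Z` and the sequence of independent copies of `Z`
    (ν : Measure E) [IsProbabilityMeasure ν]
    (Z : ℕ → Ω → E) (hZ_meas : ∀ n, Measurable (Z n)) (hZ_law : ∀ n, P.map (Z n) = ν)
    (hZ_indep : iIndepFun Z P)
    -- the algorithm: initial centres, predictable steps, recursion
    (X : ℕ → Ω → KMedians.Centers E k) (a : ℕ → Fin k → Ω → ℝ)
    (hX_meas : Measurable (X 0))
    (hX_indep : IndepFun (X 0) (fun ω n => Z n ω) P)
    (ha_meas : ∀ n r, Measurable[KMedians.history (X 0) Z n] (a n r))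
    (hX_rec : ∀ n ω r,
      X (n + 1) ω r = X n ω r - a n r ω • KMedians.direction r (Z n ω) (X n ω))
    (K C : ℝ) (hK : 0 < K)
    -- the initial centres are absolutely continuous and bounded by `K`
    (hX_ac : P.map (X 0) ≪ volume)
    (hX_bdd : ∀ᵐ ω ∂P, ∀ r, ‖X 0 ω r‖ ≤ K)
    (H1a : ν ≪ volume)
    (H1c : ∀ x : E, ‖x‖ ≤ K + 1 → ∫⁻ z, ‖z - x‖ₑ⁻¹ ∂ν < ENNReal.ofReal C)
    (H2a : ∀ᵐ ω ∂P, ∀ n r, 0 < a n r ω)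
    (H2b : ∀ᵐ ω ∂P, ∃ b : ℝ, b < min (1 / 2) (1 / (8 * C)) ∧ ∀ n r, a n r ω ≤ b)
    -- square-summable steps, almost surely or in mean along the updates
    (H3 : (∀ᵐ ω ∂P, ∀ r, Summable fun n => (a n r ω) ^ 2) ∨
      (∑ r, ∑' n, ∫⁻ ω,
        ENNReal.ofReal ((a n r ω) ^ 2 * KMedians.nearest r (Z n ω) (X n ω)) ∂P) < ∞) :
    -- first part: `Z` is bounded by `K`, or `Z` is integrable and the bound `H1c` holds on all of `E`
    (((∀ᵐ z ∂ν, ‖z‖ ≤ K) ∨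
        (Integrable (fun z : E => z) ν ∧
          ∀ x : E, ∫⁻ z, ‖z - x‖ₑ⁻¹ ∂ν < ENNReal.ofReal C)) →
      ∀ᵐ ω ∂P,
        (∃ l : ℝ, Tendsto (fun n => KMedians.objective ν (X n ω)) atTop (𝓝 l)) ∧
        ∀ r, Summable fun n => a n r ω * ‖KMedians.grad ν (X n ω) r‖ ^ 2) ∧
    -- second part: `Z` is bounded by `K`, the steps have infinite sum and comparable sizes
    ((∀ᵐ z ∂ν, ‖z‖ ≤ K) →
      (∀ᵐ ω ∂P, Tendsto (fun N => ∑ n ∈ Finset.range N, ⨆ r, a n r ω) atTop atTop) →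
      (∀ᵐ ω ∂P, BddAbove (Set.range fun n => (⨆ r, a n r ω) / (⨅ r, a n r ω))) →
      ∀ᵐ ω ∂P,
        Tendsto (fun n => KMedians.grad ν (X n ω)) atTop (𝓝 0) ∧
        Tendsto (fun n => Metric.infEDist (X n ω) (KMedians.stationaryPoints k ν))
          atTop (𝓝 0)) := by
  have hC0 : 0 ≤ C := by
    by_contra hC
    have h0 := H1c 0 (by rw [norm_zero]; linarith)
    rw [ENNReal.ofReal_of_nonpos (by linarith)] at h0
    exact not_lt_zero h0
  have h : KMedians.IsRecursion P ν Z X a :=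
    ⟨hZ_meas, hZ_law, hZ_indep, hX_meas, hX_indep, ha_meas, hX_rec, H2a, by
      filter_upwards [H2b] with ω ⟨b, hb, hab⟩ n r
      exact (hab n r).trans (hb.le.trans (min_le_left _ _))⟩
  have := KMedians.nontrivial_of_lintegral_lt (H1c 0 (by rw [norm_zero]; linarith))
  have hsum := KMedians.ae_summable_sq_mul_nearestProb h H3
  have hinj : ((∀ᵐ z ∂ν, ‖z‖ ≤ K) ∨ ∀ x : E, ∫⁻ z, ‖z - x‖ₑ⁻¹ ∂ν < ENNReal.ofReal C) →
      ∀ᵐ ω ∂P, ∀ n, Function.Injective fun r => X n ω r := fun h' =>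
    KMedians.ae_injective h hX_ac H1a (KMedians.two_le_finrank hK H1c h')
  have hbdd : (∀ᵐ z ∂ν, ‖z‖ ≤ K) →
      ∀ᵐ ω ∂P, ∀ n r, ∫⁻ z, ‖z - X n ω r‖ₑ⁻¹ ∂ν < ENNReal.ofReal C := fun hν => by
    filter_upwards [KMedians.ae_norm_apply_le_of_bounded h hX_bdd hν] with ω hω n r
    exact H1c _ (hω n r)
  have hpart : ((∀ᵐ z ∂ν, ‖z‖ ≤ K) ∨ (Integrable (fun z : E => z) ν ∧
      ∀ x : E, ∫⁻ z, ‖z - x‖ₑ⁻¹ ∂ν < ENNReal.ofReal C)) →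
      ∀ᵐ ω ∂P, (∃ l : ℝ, Tendsto (fun n => KMedians.objective ν (X n ω)) atTop (𝓝 l)) ∧
        ∀ r, Summable fun n => a n r ω * ‖KMedians.grad ν (X n ω) r‖ ^ 2 := by
    rintro (hν | ⟨hν, hC⟩)
    · exact KMedians.ae_tendsto_objective_and_summable h hk H1a
        (.of_bound aestronglyMeasurable_id K hν) hC0 hX_bdd (hinj (Or.inl hν)) (hbdd hν) hsum
    · exact KMedians.ae_tendsto_objective_and_summable h hk H1a hν hC0 hX_bdd
        (hinj (Or.inr hC)) (Eventually.of_forall fun ω n r => hC _) hsum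
  refine ⟨hpart, fun hν hdiv hratio => ?_⟩
  exact KMedians.ae_tendsto_grad h hk H1a (by linarith)
    (KMedians.ae_norm_apply_le_of_bounded h hX_bdd hν) (hinj (Or.inl hν)) (hbdd hν) hsum
    ((hpart (Or.inl hν)).mono fun ω hω => hω.2) hdiv hratio
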